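/- Let $\mathcal C$ be an abelian category with a symmetric monoidal structure $(\otimes,\phi_0,\psi_0,\mathbf 1_0)$ such that $\otimes$ is additive and exact in each variable (for instance a $\Bbbk$-linear tensor category with exact $\otimes$, over a field $\Bbbk$ of characteristic $0$). The *prolongation* $\mathbb D(\mathcal C)$ is the category whose objects $A$ are the exact sequences $0\to A_0\xrightarrow{i_A}A_1\xrightarrow{\pi_A}A_0\to0$ of $\mathcal C$ and whose morphisms are the morphisms of exact sequences with equal components at the two copies of $A_0$; put $\Pi_0(A)=A_0$. The *Yoneda sum* $A\star B$ of two objects over the same $X_0$ is $0\to X_0\to W\to X_0\to0$, where $W$ is the quotient of $A_1\times_{X_0}B_1$ by the image of $(i_A,-i_B)\colon X_0\to A_1\times_{X_0}B_1$; the map $X_0\to W$ is $x\mapsto[(i_Ax,0)]=[(0,i_Bx)]$, and $W\to X_0$ is $[(a,b)]\mapsto\pi_Aa=\pi_Bb$. Define $A\otimes B$ in $\mathbb D(\mathcal C)$ as the Yoneda sum of $A\otimes B_0$ and $A_0\otimes B$ (tensored termwise), with $f\otimes g$ induced by $f_1\otimes g_0$ and $f_0\otimes g_1$. Let $\mathbf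 1$ be $0\to\mathbf 1_0\to\mathbf 1_0\oplus\mathbf 1_0\to\mathbf 1_0\to0$ (first inclusion, second projection), with unit isomorphism $\mathbf 1\otimes A\cong A$ induced by $((x,y),a)\mapsto i_A(x)+a$, and similarly $A\otimes\mathbf 1\cong A$. Let $\phi$ be the associativity constraint over $\phi_0$ obtained by identifying both $(A\otimes B)\otimes D$ and $A\otimes(B\otimes D)$ with the quotient of $$A_1\otimes B_0\otimes D_0\times_{A_0\otimes B_0\otimes D_0}A_0\otimes B_1\otimes D_0\times_{A_0\otimes B_0\otimes D_0}A_0\otimes B_0\otimes D_1$$ that identifies the three inclusions of $A_0\otimes B_0\otimes D_0$, and let $\psi$ be the commutativity constraint over $\psi_0$ induced by $\psi_0$ and $(a,b)\mapsto(b,a)$. Then: 1. $(\mathbb D(\mathcal C),\otimes,\phi,\psi,\mathbf 1)$ is a symmetric monoidal category. 2. $\Pi_0\colon\mathbb D(\mathcal C)\to\mathcal C$ is a symmetric monoidal functor, with structure isomorphisms the identities of $A_0\otimes B_0$ and of $\mathbf 1_0$. 3. If $\mathcal C$ is rigid (closed, with every $X\to X^{\vee\vee}$ and every $\underline{Hom}(X_1,Y_1)\otimes\underline{Hom}(X_2,Y_2)\to\underline{Hom}(X_1\otimes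 X_2,Y_1\otimes Y_2)$ an isomorphism, where $X^\vee=\underline{Hom}(X,\mathbf 1_0)$), then so is $\mathbb D(\mathcal C)$. Moreover, for every $A$ the dual sequence $A^\vee\colon0\to A_0^\vee\xrightarrow{\pi_A^\vee}A_1^\vee\xrightarrow{i_A^\vee}A_0^\vee\to0$ is exact, and there is a morphism $e\colon A\otimes A^\vee\to\mathbf 1$ over the evaluation of $A_0$, whose composite $A_1\otimes A_1^\vee\to(A\otimes A^\vee)_1\to\mathbf 1_0\oplus\mathbf 1_0\to\mathbf 1_0$ with the canonical map $a\otimes b\mapsto[(a\otimes\pi b,\pi a\otimes b)]$ and the first projection is the evaluation of $A_1$, and for which the induced map $A^\vee\to\underline{Hom}(A,\mathbf 1)$ is an isomorphism. -/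

import Mathlib

open CategoryTheory CategoryTheory.Limits CategoryTheory.MonoidalCategory

universe v u

noncomputable section

/-! ## Self-extensions and their Yoneda sum -/

/-- An exact sequence `0 ⟶ X ⟶ mid ⟶ X ⟶ 0`. -/
structure SelfExtension {C : Type u} [Category.{v} C] [Abelian C] (X : C) where
  mid : C
  incl : X ⟶ mid
  proj : mid ⟶ X
  zero : incl ≫ proj = 0
  shortExact : (ShortComplex.mk incl proj zero).ShortExact

namespace SelfExtension

variable {C : Type u} [Category.{v} C] [Abelian C] {X : C}

instance (E : SelfExtension X) : Mono E.incl := E.shortExact.mono_f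
instance (E : SelfExtension X) : Epi E.proj := E.shortExact.epi_g

theorem exists_lift (E : SelfExtension X) {T : C} (x : T ⟶ E.mid) (hx : x ≫ E.proj = 0) :
    ∃ w : T ⟶ X, x = w ≫ E.incl :=
  ⟨E.shortExact.exact.lift x hx, (E.shortExact.exact.lift_f x hx).symm⟩

attribute [local simp] pullback.lift_fst pullback.lift_snd pullback.lift_fst_assoc
  pullback.lift_snd_assoc

/-- A morphism of exact sequences whose two components at the outer terms are both `f`. -/
@[ext]
structure HomOver {X Y : C} (f : X ⟶ Y) (E : SelfExtension X) (F : SelfExtension Y) where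
  mid : E.mid ⟶ F.mid
  incl_mid : E.incl ≫ mid = f ≫ F.incl
  mid_proj : mid ≫ F.proj = E.proj ≫ f

namespace HomOver

variable {Y Z : C}

@[simps]
def id (E : SelfExtension X) : HomOver (𝟙 X) E E := ⟨𝟙 _, by simp, by simp⟩

@[simps]
def comp {f : X ⟶ Y} {g : Y ⟶ Z} {h : X ⟶ Z} {E : SelfExtension X} {F : SelfExtension Y}
    {G : SelfExtension Z} (m : HomOver f E F) (n : HomOver g F G) (e : f ≫ g = h) :
    HomOver h E G where
  mid := m.mid ≫ n.mid
  incl_mid := by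
    rw [← Category.assoc, m.incl_mid, Category.assoc, n.incl_mid, ← Category.assoc, e]
  mid_proj := by rw [Category.assoc, n.mid_proj, ← Category.assoc, m.mid_proj, Category.assoc, e]

theorem isIso_mid {f : X ⟶ Y} [IsIso f] {E : SelfExtension X} {F : SelfExtension Y}
    (m : HomOver f E F) : IsIso m.mid := by
  let φ : ShortComplex.mk E.incl E.proj E.zero ⟶ ShortComplex.mk F.incl F.proj F.zero :=
    { τ₁ := f, τ₂ := m.mid, τ₃ := f, comm₁₂ := m.incl_mid.symm, comm₂₃ := m.mid_proj }
  have : IsIso φ.τ₁ := by dsimp [φ]; infer_instance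
  have : IsIso φ.τ₃ := by dsimp [φ]; infer_instance
  exact ShortComplex.isIso₂_of_shortExact_of_isIso₁₃ φ E.shortExact F.shortExact

/-- By the five lemma, a morphism over an isomorphism is invertible. -/
@[simps]
def symm {f : X ≅ Y} {E : SelfExtension X} {F : SelfExtension Y} (m : HomOver f.hom E F) :
    HomOver f.inv F E :=
  haveI := m.isIso_mid
  { mid := inv m.mid
    incl_mid := by rw [IsIso.comp_inv_eq, Category.assoc, m.incl_mid, f.inv_hom_id_assoc]
    mid_proj := by
      rw [IsIso.inv_comp_eq, ← Category.assoc, m.mid_proj, Category.assoc, f.hom_inv_id,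
        Category.comp_id] }

end HomOver

/-- The fibre product `E₁ ×_X F₁`. -/
abbrev fibre (E F : SelfExtension X) : C := pullback E.proj F.proj

/-- The map `(ι_E, -ι_F) : X ⟶ E₁ ×_X F₁`. -/
def antidiag (E F : SelfExtension X) : X ⟶ fibre E F :=
  pullback.lift E.incl (-F.incl) (by simp [E.zero, F.zero])

/-- The middle term of the Yoneda sum, the quotient of `E₁ ×_X F₁` by the image of
`(ι_E, -ι_F)`. -/
abbrev sumMid (E F : SelfExtension X) : C := cokernel (antidiag E F)

def sumQuot (E F : SelfExtension X) : fibre E F ⟶ sumMid E F := cokernel.π (antidiag E F)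

/-- The map to the Yoneda sum given by a compatible pair of maps to `E₁` and `F₁`. -/
def sumMk (E F : SelfExtension X) {T : C} (a : T ⟶ E.mid) (b : T ⟶ F.mid)
    (h : a ≫ E.proj = b ≫ F.proj) : T ⟶ sumMid E F :=
  pullback.lift a b h ≫ sumQuot E F

/-- The map out of the Yoneda sum induced by a map out of `E₁ ×_X F₁`. -/
def sumDesc (E F : SelfExtension X) {T : C} (k : fibre E F ⟶ T) (h : antidiag E F ≫ k = 0) :
    sumMid E F ⟶ T :=
  cokernel.desc _ k h

instance (E F : SelfExtension X) : Epi (sumQuot E F) := by unfold sumQuot; infer_instance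

instance (E F : SelfExtension X) : Mono (antidiag E F) := by
  have : Mono (antidiag E F ≫ pullback.fst E.proj F.proj) := by
    unfold antidiag
    rw [pullback.lift_fst]
    infer_instance
  exact mono_of_mono _ (pullback.fst E.proj F.proj)

@[simp]
theorem sumQuot_desc (E F : SelfExtension X) {T : C} (k : fibre E F ⟶ T)
    (h : antidiag E F ≫ k = 0) : sumQuot E F ≫ sumDesc E F k h = k :=
  cokernel.π_desc _ _ _

theorem sumMk_desc (E F : SelfExtension X) {T S : C} (a : T ⟶ E.mid) (b : T ⟶ F.mid)
    (hab : a ≫ E.proj = b ≫ F.proj) (k : fibre E F ⟶ S) (h : antidiag E F ≫ k = 0) :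
    sumMk E F a b hab ≫ sumDesc E F k h = pullback.lift a b hab ≫ k := by
  simp [sumMk]

theorem comp_sumMk (E F : SelfExtension X) {S T : C} (t : S ⟶ T) (a : T ⟶ E.mid) (b : T ⟶ F.mid)
    (h : a ≫ E.proj = b ≫ F.proj) :
    t ≫ sumMk E F a b h = sumMk E F (t ≫ a) (t ≫ b) (by simp [h]) := by
  have e : t ≫ pullback.lift a b h =
      pullback.lift (t ≫ a) (t ≫ b) (by simp [h]) := by
    apply pullback.hom_ext <;> simp
  rw [sumMk, sumMk, ← e, Category.assoc]

theorem sumMk_congr (E F : SelfExtension X) {T : C} {a a' : T ⟶ E.mid} {b b' : T ⟶ F.mid}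
    (h : a ≫ E.proj = b ≫ F.proj) (ha : a = a') (hb : b = b') :
    sumMk E F a b h = sumMk E F a' b' (by rw [← ha, ← hb, h]) := by
  subst ha hb; rfl

theorem sumQuot_eq_mk (E F : SelfExtension X) :
    sumQuot E F = sumMk E F (pullback.fst _ _) (pullback.snd _ _) pullback.condition := by
  unfold sumMk
  rw [show pullback.lift (pullback.fst E.proj F.proj) (pullback.snd E.proj F.proj)
    pullback.condition = 𝟙 (fibre E F) from by apply pullback.hom_ext <;> simp]
  simp

theorem quot_exact (E F : SelfExtension X) :
    (ShortComplex.mk (antidiag E F) (sumQuot E F) (cokernel.condition _)).ShortExact where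
  exact := ShortComplex.exact_cokernel _
  mono_f := by dsimp; infer_instance
  epi_g := by dsimp; infer_instance

theorem sumMk_eq_zero_iff (E F : SelfExtension X) {T : C} (a : T ⟶ E.mid) (b : T ⟶ F.mid)
    (h : a ≫ E.proj = b ≫ F.proj) :
    sumMk E F a b h = 0 ↔ ∃ w : T ⟶ X, a = w ≫ E.incl ∧ b = -(w ≫ F.incl) := by
  constructor
  · intro h0
    obtain ⟨w, hw⟩ : ∃ w, w ≫ antidiag E F = pullback.lift a b h :=
      ⟨(quot_exact E F).exact.lift _ h0, (quot_exact E F).exact.lift_f _ h0⟩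
    refine ⟨w, ?_, ?_⟩
    · have := congrArg (· ≫ pullback.fst E.proj F.proj) hw
      simpa [antidiag] using this.symm
    · have := congrArg (· ≫ pullback.snd E.proj F.proj) hw
      simpa [antidiag] using this.symm
  · rintro ⟨w, rfl, rfl⟩
    have : pullback.lift (w ≫ E.incl) (-(w ≫ F.incl)) h = w ≫ antidiag E F := by
      apply pullback.hom_ext <;> simp [antidiag]
    unfold sumMk
    rw [this, Category.assoc]
    simp [sumQuot]

theorem sumMk_sub (E F : SelfExtension X) {T : C} (a a' : T ⟶ E.mid) (b b' : T ⟶ F.mid)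
    (h : a ≫ E.proj = b ≫ F.proj) (h' : a' ≫ E.proj = b' ≫ F.proj) :
    sumMk E F a b h - sumMk E F a' b' h' =
      sumMk E F (a - a') (b - b') (by simp [Preadditive.sub_comp, h, h']) := by
  have e : pullback.lift a b h - pullback.lift a' b' h' =
      pullback.lift (a - a') (b - b') (by simp [Preadditive.sub_comp, h, h']) := by
    apply pullback.hom_ext <;> simp [Preadditive.sub_comp]
  rw [sumMk, sumMk, sumMk, ← e, Preadditive.sub_comp]

theorem sumMk_eq_iff (E F : SelfExtension X) {T : C} {a a' : T ⟶ E.mid} {b b' : T ⟶ F.mid}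
    (h : a ≫ E.proj = b ≫ F.proj) (h' : a' ≫ E.proj = b' ≫ F.proj) :
    sumMk E F a b h = sumMk E F a' b' h' ↔
      ∃ w : T ⟶ X, a = a' + w ≫ E.incl ∧ b = b' - w ≫ F.incl := by
  rw [← sub_eq_zero, sumMk_sub, sumMk_eq_zero_iff]
  constructor <;> rintro ⟨w, h1, h2⟩ <;> refine ⟨w, ?_, ?_⟩
  · rw [← h1]; abel
  · rw [eq_sub_iff_add_eq, ← sub_eq_zero, add_sub_right_comm, h2]; abel
  · rw [h1]; abel
  · rw [h2]; abel

/-- The map `X ⟶ E₁ ×_X F₁ ⟶ (E ⋆ F)₁`, `x ↦ [(ι_E x, 0)] = [(0, ι_F x)]`. -/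
def sumIncl (E F : SelfExtension X) : X ⟶ sumMid E F :=
  sumMk E F E.incl 0 (by simp [E.zero])

theorem sumIncl_eq (E F : SelfExtension X) :
    sumIncl E F = sumMk E F 0 F.incl (by simp [F.zero]) := by
  unfold sumIncl
  rw [sumMk_eq_iff]
  exact ⟨𝟙 X, by simp, by simp⟩

/-- The map `(E ⋆ F)₁ ⟶ X`, `[(a, b)] ↦ π_E a = π_F b`. -/
def sumProj (E F : SelfExtension X) : sumMid E F ⟶ X :=
  sumDesc E F (pullback.fst E.proj F.proj ≫ E.proj) (by simp [antidiag, E.zero])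

theorem sumMk_proj (E F : SelfExtension X) {T : C} (a : T ⟶ E.mid) (b : T ⟶ F.mid)
    (h : a ≫ E.proj = b ≫ F.proj) : sumMk E F a b h ≫ sumProj E F = a ≫ E.proj := by
  simp [sumProj, sumMk_desc]

theorem sumQuot_proj (E F : SelfExtension X) :
    sumQuot E F ≫ sumProj E F = pullback.fst E.proj F.proj ≫ E.proj := by
  simp [sumProj]

theorem exists_sumMk (E F : SelfExtension X) {T : C} (x : T ⟶ sumMid E F) :
    ∃ (T' : C) (t : T' ⟶ T) (_ : Epi t) (a : T' ⟶ E.mid) (b : T' ⟶ F.mid)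
      (h : a ≫ E.proj = b ≫ F.proj), t ≫ x = sumMk E F a b h := by
  obtain ⟨T', t, ht, y, hy⟩ := surjective_up_to_refinements_of_epi (sumQuot E F) x
  refine ⟨T', t, ht, y ≫ pullback.fst _ _, y ≫ pullback.snd _ _, ?_, ?_⟩
  · simp [pullback.condition]
  · rw [hy, sumQuot_eq_mk, comp_sumMk]

theorem sum_zero (E F : SelfExtension X) : sumIncl E F ≫ sumProj E F = 0 := by
  simp [sumIncl, sumMk_proj, E.zero]

theorem sum_shortExact (E F : SelfExtension X) :
    (ShortComplex.mk (sumIncl E F) (sumProj E F) (sum_zero E F)).ShortExact where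
  exact := by
    rw [ShortComplex.exact_iff_exact_up_to_refinements]
    intro T x hx
    obtain ⟨T', t, ht, a, b, h, e⟩ := exists_sumMk E F x
    have h0 : a ≫ E.proj = 0 := by
      have := congrArg (t ≫ ·) hx
      dsimp at this
      rwa [← Category.assoc, e, sumMk_proj, comp_zero] at this
    obtain ⟨w, rfl⟩ := E.exists_lift a h0
    obtain ⟨w', rfl⟩ := F.exists_lift b (h ▸ h0)
    refine ⟨T', t, ht, w + w', ?_⟩
    dsimp
    rw [e, sumIncl, comp_sumMk, sumMk_eq_iff]
    exact ⟨-w', by simp, by simp⟩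
  mono_f := by
    have key : ∀ {T : C} (x : T ⟶ X), x ≫ sumIncl E F = 0 → x = 0 := by
      intro T x hx
      unfold sumIncl at hx
      rw [comp_sumMk, sumMk_eq_zero_iff] at hx
      obtain ⟨w, h1, h2⟩ := hx
      rw [cancel_mono] at h1
      rw [h1, ← cancel_mono F.incl]
      simpa using h2.symm
    exact Preadditive.mono_of_cancel_zero _ fun x hx => key x hx
  epi_g := by
    dsimp
    have : Epi (sumQuot E F ≫ sumProj E F) := by
      unfold sumProj
      rw [sumQuot_desc]
      exact epi_comp _ _
    exact epi_of_epi (sumQuot E F) _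

/-- The Yoneda sum (Baer sum) `E ⋆ F`. -/
abbrev yonedaSum (E F : SelfExtension X) : SelfExtension X where
  mid := sumMid E F
  incl := sumIncl E F
  proj := sumProj E F
  zero := sum_zero E F
  shortExact := sum_shortExact E F

/-- The morphism `m ⋆ n`, induced by the map `(a, b) ↦ (m a, n b)` of fibre products. -/
abbrev sumMap {Y : C} {f : X ⟶ Y} {E F : SelfExtension X} {E' F' : SelfExtension Y}
    (m : HomOver f E E') (n : HomOver f F F') :
    HomOver f (yonedaSum E F) (yonedaSum E' F') where
  mid := sumDesc E F
    (sumMk E' F' (pullback.fst _ _ ≫ m.mid) (pullback.snd _ _ ≫ n.mid)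
      (by simp [m.mid_proj, n.mid_proj, pullback.condition_assoc]))
    (by
      rw [comp_sumMk, sumMk_eq_zero_iff]
      exact ⟨f, by simp [antidiag, m.incl_mid], by simp [antidiag, n.incl_mid]⟩)
  incl_mid := by
    dsimp only [sumIncl]
    rw [sumMk_desc, comp_sumMk, comp_sumMk]
    exact sumMk_congr _ _ _ (by simp [m.incl_mid]) (by simp)
  mid_proj := by
    change _ ≫ sumProj E' F' = sumProj E F ≫ f
    rw [← cancel_epi (sumQuot E F), ← Category.assoc, sumQuot_desc, sumMk_proj, ← Category.assoc,
      sumQuot_proj, Category.assoc, m.mid_proj, Category.assoc]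

/-- The commutativity of the Yoneda sum, induced by `(a, b) ↦ (b, a)`. -/
abbrev sumSwap (E F : SelfExtension X) : HomOver (𝟙 X) (yonedaSum E F) (yonedaSum F E) where
  mid := sumDesc E F
    (sumMk F E (pullback.snd _ _) (pullback.fst _ _) pullback.condition.symm)
    (by
      rw [comp_sumMk, sumMk_eq_zero_iff]
      exact ⟨-𝟙 X, by simp [antidiag], by simp [antidiag]⟩)
  incl_mid := by
    change sumIncl E F ≫ _ = 𝟙 X ≫ sumIncl F E
    rw [sumIncl_eq F E]
    unfold sumIncl
    rw [sumMk_desc, comp_sumMk, comp_sumMk]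
    exact sumMk_congr _ _ _ (by simp) (by simp)
  mid_proj := by
    change _ ≫ sumProj F E = sumProj E F ≫ 𝟙 X
    rw [← cancel_epi (sumQuot E F), ← Category.assoc, sumQuot_desc, sumMk_proj, Category.comp_id,
      sumQuot_proj, pullback.condition]

/-! ### Associativity of the Yoneda sum -/

section Assoc

variable (E F G : SelfExtension X)

/-- The triple fibre product `E₁ ×_X F₁ ×_X G₁`. -/
abbrev triple : C := pullback (pullback.fst E.proj F.proj ≫ E.proj) G.proj

abbrev triple₁ : triple E F G ⟶ E.mid := pullback.fst _ _ ≫ pullback.fst _ _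
abbrev triple₂ : triple E F G ⟶ F.mid := pullback.fst _ _ ≫ pullback.snd _ _
abbrev triple₃ : triple E F G ⟶ G.mid := pullback.snd _ _

theorem triple_condition₁₂ : triple₁ E F G ≫ E.proj = triple₂ E F G ≫ F.proj := by
  simp [pullback.condition]

theorem triple_condition₁₃ : triple₁ E F G ≫ E.proj = triple₃ E F G ≫ G.proj := by
  simp [← pullback.condition]

/-- The quotient map `(a, b, c) ↦ [([(a, b)], c)]` to the middle term of `(E ⋆ F) ⋆ G`. -/
def leftBracket : triple E F G ⟶ sumMid (yonedaSum E F) G :=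
  sumMk (yonedaSum E F) G
    (sumMk E F (triple₁ E F G) (triple₂ E F G) (triple_condition₁₂ E F G)) (triple₃ E F G)
    (by rw [sumMk_proj, triple_condition₁₃])

/-- The quotient map `(a, b, c) ↦ [(a, [(b, c)])]` to the middle term of `E ⋆ (F ⋆ G)`. -/
def rightBracket : triple E F G ⟶ sumMid E (yonedaSum F G) :=
  sumMk E (yonedaSum F G) (triple₁ E F G)
    (sumMk F G (triple₂ E F G) (triple₃ E F G)
      (by rw [← triple_condition₁₂, triple_condition₁₃]))
    (by rw [sumMk_proj, triple_condition₁₂])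

instance : Epi (leftBracket E F G) := by
  rw [epi_iff_surjective_up_to_refinements]
  intro T x
  obtain ⟨T₁, t₁, ht₁, s, c, hs, e₁⟩ := exists_sumMk (yonedaSum E F) G x
  obtain ⟨T₂, t₂, ht₂, a, b, hab, e₂⟩ := exists_sumMk E F s
  have hc : a ≫ E.proj = (t₂ ≫ c) ≫ G.proj := by
    rw [Category.assoc, ← hs, ← Category.assoc]
    dsimp only [yonedaSum]
    rw [e₂, sumMk_proj]
  refine ⟨T₂, t₂ ≫ t₁, epi_comp _ _,
    pullback.lift (pullback.lift a b hab) (t₂ ≫ c) (by simpa using hc), ?_⟩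
  rw [Category.assoc, e₁, leftBracket, comp_sumMk, comp_sumMk]
  apply sumMk_congr
  · rw [e₂, comp_sumMk]
    exact sumMk_congr _ _ _ (by simp) (by simp)
  · simp

theorem comp_rightBracket_eq_zero {T : C} (k : T ⟶ triple E F G)
    (h : k ≫ leftBracket E F G = 0) : k ≫ rightBracket E F G = 0 := by
  unfold leftBracket at h
  rw [comp_sumMk, sumMk_eq_zero_iff] at h
  obtain ⟨w, h₁, h₂⟩ := h
  replace h₁ : k ≫ sumMk E F (triple₁ E F G) (triple₂ E F G) (triple_condition₁₂ E F G) =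
    w ≫ sumMk E F E.incl 0 (by simp [E.zero]) := h₁
  rw [comp_sumMk, comp_sumMk, sumMk_eq_iff] at h₁
  obtain ⟨w', h₃, h₄⟩ := h₁
  unfold rightBracket
  rw [comp_sumMk, sumMk_eq_zero_iff]
  refine ⟨w + w', by rw [h₃, Preadditive.add_comp], ?_⟩
  change _ = -((w + w') ≫ sumMk F G F.incl 0 (by simp [F.zero]))
  rw [← Preadditive.neg_comp, comp_sumMk, comp_sumMk, sumMk_eq_iff]
  exact ⟨w, by rw [h₄]; simp, by rw [h₂]; simp⟩

/-- The associativity isomorphism `(E ⋆ F) ⋆ G ≅ E ⋆ (F ⋆ G)`: both sides are the quotient of the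
triple fibre product that identifies the three inclusions of `X`. -/
abbrev sumAssoc : HomOver (𝟙 X) (yonedaSum (yonedaSum E F) G) (yonedaSum E (yonedaSum F G)) where
  mid := Abelian.epiDesc (leftBracket E F G) (rightBracket E F G)
    (comp_rightBracket_eq_zero E F G _ (kernel.condition _))
  incl_mid := by
    let j : X ⟶ triple E F G := pullback.lift (pullback.lift E.incl 0 (by simp [E.zero])) 0
      (by simp [E.zero])
    have h₁ : sumIncl (yonedaSum E F) G = j ≫ leftBracket E F G := by
      unfold leftBracket sumIncl
      rw [comp_sumMk]
      apply sumMk_congr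
      · change sumMk E F _ _ _ = _
        rw [comp_sumMk]
        exact sumMk_congr _ _ _ (by simp [j]) (by simp [j])
      · simp [j]
    have h₂ : j ≫ rightBracket E F G = sumIncl E (yonedaSum F G) := by
      unfold rightBracket sumIncl
      rw [comp_sumMk]
      apply sumMk_congr
      · simp [j]
      · rw [comp_sumMk, sumMk_eq_zero_iff]
        exact ⟨0, by simp [j], by simp [j]⟩
    change sumIncl (yonedaSum E F) G ≫ _ = 𝟙 X ≫ sumIncl E (yonedaSum F G)
    rw [h₁, Category.assoc, Abelian.comp_epiDesc, h₂, Category.id_comp]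
  mid_proj := by
    change _ ≫ sumProj E (yonedaSum F G) = sumProj (yonedaSum E F) G ≫ 𝟙 X
    rw [← cancel_epi (leftBracket E F G), Category.comp_id, ← Category.assoc,
      Abelian.comp_epiDesc]
    unfold leftBracket rightBracket
    rw [sumMk_proj, sumMk_proj]
    change _ = _ ≫ sumProj E F
    rw [sumMk_proj]

end Assoc

/-! ### Exact functors and Yoneda sums -/

section Exact

variable (G : C ⥤ C) [G.PreservesZeroMorphisms] [PreservesFiniteLimits G]
  [PreservesFiniteColimits G]

/-- The exact sequence obtained by applying an exact functor termwise. -/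
abbrev map (E : SelfExtension X) : SelfExtension (G.obj X) where
  mid := G.obj E.mid
  incl := G.map E.incl
  proj := G.map E.proj
  zero := by rw [← G.map_comp, E.zero, G.map_zero]
  shortExact := E.shortExact.map_of_exact G

/-- The canonical map `(G E ⋆ G F)₁ ⟶ G ((E ⋆ F)₁)` for an exact functor `G`; it uses that `G`
preserves the fibre product `E₁ ×_X F₁`. -/
def mapSumMid (E F : SelfExtension X) : sumMid (E.map G) (F.map G) ⟶ G.obj (sumMid E F) :=
  sumDesc (E.map G) (F.map G)
    ((PreservesPullback.iso G E.proj F.proj).inv ≫ G.map (sumQuot E F)) (by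
      have : antidiag (E.map G) (F.map G) ≫ (PreservesPullback.iso G E.proj F.proj).inv =
          G.map (antidiag E F) := by
        rw [Iso.comp_inv_eq]
        apply pullback.hom_ext
        · simp [antidiag]
        · have : Functor.Additive G := Functor.additive_of_preserves_binary_products G
          simp [antidiag]
      rw [← Category.assoc, this, ← G.map_comp]
      simp [sumQuot])

theorem sumMk_mapSumMid (E F : SelfExtension X) {T : C} (a : T ⟶ G.obj E.mid) (b : T ⟶ G.obj F.mid)
    (h : a ≫ G.map E.proj = b ≫ G.map F.proj) :
    sumMk (E.map G) (F.map G) a b h ≫ mapSumMid G E F =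
      pullback.lift a b h ≫ (PreservesPullback.iso G E.proj F.proj).inv ≫ G.map (sumQuot E F) := by
  unfold mapSumMid
  rw [sumMk_desc]

theorem map_sumMk (E F : SelfExtension X) {T : C} (a : T ⟶ E.mid) (b : T ⟶ F.mid)
    (h : a ≫ E.proj = b ≫ F.proj) :
    G.map (sumMk E F a b h) = sumMk (E.map G) (F.map G) (G.map a) (G.map b)
      (by rw [← G.map_comp, h, G.map_comp]) ≫ mapSumMid G E F := by
  rw [sumMk_mapSumMid, sumMk, G.map_comp, ← Category.assoc (pullback.lift _ _ _)]
  congr 1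
  rw [Iso.eq_comp_inv]
  apply pullback.hom_ext <;> simp

theorem sumIncl_mapSumMid (E F : SelfExtension X) :
    sumIncl (E.map G) (F.map G) ≫ mapSumMid G E F = G.map (sumIncl E F) := by
  unfold sumIncl
  rw [map_sumMk]
  congr 1
  exact sumMk_congr _ _ _ rfl (by simp)

theorem mapSumMid_proj (E F : SelfExtension X) :
    mapSumMid G E F ≫ G.map (sumProj E F) = sumProj (E.map G) (F.map G) := by
  rw [← cancel_epi (sumQuot (E.map G) (F.map G))]
  unfold mapSumMid sumProj
  simp only [sumQuot_desc, ← Category.assoc]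
  simp only [Category.assoc, ← G.map_comp, sumQuot_desc]
  simp

/-- The canonical isomorphism `G E ⋆ G F ≅ G (E ⋆ F)` for an exact functor `G`. -/
abbrev mapSum (E F : SelfExtension X) :
    HomOver (𝟙 (G.obj X)) (yonedaSum (E.map G) (F.map G)) ((yonedaSum E F).map G) where
  mid := mapSumMid G E F
  incl_mid := by simp [sumIncl_mapSumMid]
  mid_proj := by simp [mapSumMid_proj]

end Exact

end SelfExtension

/-! ## The prolongation -/

/-- An object of the prolongation of `C`: an exact sequence `0 ⟶ X₀ ⟶ X₁ ⟶ X₀ ⟶ 0`. -/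
structure Prolongation (C : Type u) [Category.{v} C] [Abelian C] where
  base : C
  ext : SelfExtension base

namespace Prolongation

open SelfExtension

section Category

variable {C : Type u} [Category.{v} C] [Abelian C]

/-- A morphism of exact sequences whose two components at `X₀` coincide. -/
structure Hom (A B : Prolongation C) where
  base : A.base ⟶ B.base
  ext : HomOver base A.ext B.ext

theorem Hom.ext' {A B : Prolongation C} {f g : Hom A B} (h₀ : f.base = g.base)
    (h₁ : f.ext.mid = g.ext.mid) : f = g := by
  obtain ⟨f₀, f₁⟩ := f
  obtain ⟨g₀, g₁⟩ := g
  obtain rfl : f₀ = g₀ := h₀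
  exact congrArg (Hom.mk f₀) (HomOver.ext h₁)

@[simps]
instance : Category (Prolongation C) where
  Hom := Hom
  id _ := ⟨𝟙 _, HomOver.id _⟩
  comp f g := ⟨f.base ≫ g.base, f.ext.comp g.ext rfl⟩
  id_comp _ := Hom.ext' (Category.id_comp _) (Category.id_comp _)
  comp_id _ := Hom.ext' (Category.comp_id _) (Category.comp_id _)
  assoc _ _ _ := Hom.ext' (Category.assoc _ _ _) (Category.assoc _ _ _)

theorem hom_ext {A B : Prolongation C} {f g : A ⟶ B} (h₀ : f.base = g.base)
    (h₁ : f.ext.mid = g.ext.mid) : f = g :=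
  Hom.ext' h₀ h₁

/-- The isomorphism given by a morphism of exact sequences over an isomorphism of `C`. -/
@[simps]
def isoOver {A B : Prolongation C} (f : A.base ≅ B.base) (m : HomOver f.hom A.ext B.ext) :
    A ≅ B where
  hom := ⟨f.hom, m⟩
  inv := ⟨f.inv, m.symm⟩
  hom_inv_id := by
    have := m.isIso_mid
    apply hom_ext <;> simp
  inv_hom_id := by
    have := m.isIso_mid
    apply hom_ext <;> simp

variable (C) in
/-- The functor `X ↦ X₀`. -/
@[simps]
def Pi₀ : Prolongation C ⥤ C where
  obj A := A.base
  map f := f.base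

end Category

end Prolongation

/-! ## The tensor structure on the prolongation -/

section Tensor

variable {C : Type u} [Category.{v} C] [Abelian C] [MonoidalCategory C] [MonoidalPreadditive C]
  [SymmetricCategory C]
  [∀ X : C, PreservesFiniteLimits (tensorLeft X)]
  [∀ X : C, PreservesFiniteColimits (tensorLeft X)]

instance preservesFiniteLimits_tensorRight' (X : C) : PreservesFiniteLimits (tensorRight X) :=
  preservesFiniteLimits_of_natIso (BraidedCategory.tensorLeftIsoTensorRight X)

instance preservesFiniteColimits_tensorRight' (X : C) : PreservesFiniteColimits (tensorRight X) :=
  preservesFiniteColimits_of_natIso (BraidedCategory.tensorLeftIsoTensorRight X)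

namespace SelfExtension

variable {X Y : C}

/-- The exact sequence `E ⊗ Z`, tensored termwise. -/
abbrev tensorR (E : SelfExtension X) (Z : C) : SelfExtension (X ⊗ Z) where
  mid := E.mid ⊗ Z
  incl := E.incl ▷ Z
  proj := E.proj ▷ Z
  zero := (E.map (tensorRight Z)).zero
  shortExact := (E.map (tensorRight Z)).shortExact

/-- The exact sequence `Z ⊗ E`, tensored termwise. -/
abbrev tensorL (Z : C) (E : SelfExtension X) : SelfExtension (Z ⊗ X) where
  mid := Z ⊗ E.mid
  incl := Z ◁ E.incl
  proj := Z ◁ E.proj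
  zero := (E.map (tensorLeft Z)).zero
  shortExact := (E.map (tensorLeft Z)).shortExact

/-- The canonical isomorphism `(E ⊗ Z) ⋆ (F ⊗ Z) ≅ (E ⋆ F) ⊗ Z`. -/
abbrev sumTensorR (E F : SelfExtension X) (Z : C) :
    HomOver (𝟙 (X ⊗ Z)) (yonedaSum (E.tensorR Z) (F.tensorR Z)) ((yonedaSum E F).tensorR Z) :=
  mapSum (tensorRight Z) E F

/-- The canonical isomorphism `(Z ⊗ E) ⋆ (Z ⊗ F) ≅ Z ⊗ (E ⋆ F)`. -/
abbrev sumTensorL (Z : C) (E F : SelfExtension X) :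
    HomOver (𝟙 (Z ⊗ X)) (yonedaSum (tensorL Z E) (tensorL Z F)) (tensorL Z (yonedaSum E F)) :=
  mapSum (tensorLeft Z) E F

@[simps]
def HomOver.tensorR {f : X ⟶ Y} {E : SelfExtension X} {F : SelfExtension Y} (m : HomOver f E F)
    {Z W : C} (g : Z ⟶ W) : HomOver (f ⊗ₘ g) (E.tensorR Z) (F.tensorR W) where
  mid := m.mid ⊗ₘ g
  incl_mid := by
    change E.incl ▷ Z ≫ _ = _ ≫ F.incl ▷ W
    rw [← tensorHom_id, ← tensorHom_id, tensorHom_comp_tensorHom, tensorHom_comp_tensorHom,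
      m.incl_mid, Category.id_comp, Category.comp_id]
  mid_proj := by
    change _ ≫ F.proj ▷ W = E.proj ▷ Z ≫ _
    rw [← tensorHom_id, ← tensorHom_id, tensorHom_comp_tensorHom, tensorHom_comp_tensorHom,
      m.mid_proj, Category.id_comp, Category.comp_id]

@[simps]
def HomOver.tensorL {f : X ⟶ Y} {E : SelfExtension X} {F : SelfExtension Y}
    {Z W : C} (g : Z ⟶ W) (m : HomOver f E F) : HomOver (g ⊗ₘ f) (tensorL Z E) (tensorL W F) where
  mid := g ⊗ₘ m.mid
  incl_mid := by
    change Z ◁ E.incl ≫ _ = _ ≫ W ◁ F.incl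
    rw [← id_tensorHom, ← id_tensorHom, tensorHom_comp_tensorHom, tensorHom_comp_tensorHom,
      m.incl_mid, Category.id_comp, Category.comp_id]
  mid_proj := by
    change _ ≫ W ◁ F.proj = Z ◁ E.proj ≫ _
    rw [← id_tensorHom, ← id_tensorHom, tensorHom_comp_tensorHom, tensorHom_comp_tensorHom,
      m.mid_proj, Category.id_comp, Category.comp_id]

/-- The associativity constraint of `C`, applied termwise. -/
@[simps]
def assocLLR (E : SelfExtension X) (Y Z : C) :
    HomOver (α_ X Y Z).hom ((E.tensorR Y).tensorR Z) (E.tensorR (Y ⊗ Z)) :=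
  ⟨(α_ _ _ _).hom, by simp, by simp⟩

@[simps]
def assocM (Y : C) (E : SelfExtension X) (Z : C) :
    HomOver (α_ Y X Z).hom ((tensorL Y E).tensorR Z) (tensorL Y (E.tensorR Z)) :=
  ⟨(α_ _ _ _).hom, by simp, by simp⟩

@[simps]
def assocR (Y Z : C) (E : SelfExtension X) :
    HomOver (α_ Y Z X).hom (tensorL (Y ⊗ Z) E) (tensorL Y (tensorL Z E)) :=
  ⟨(α_ _ _ _).hom, by simp, by simp⟩

@[simps]
def braidR (E : SelfExtension X) (Z : C) : HomOver (β_ X Z).hom (E.tensorR Z) (tensorL Z E) :=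
  ⟨(β_ _ _).hom, by simp, by simp⟩

@[simps]
def braidL (Z : C) (E : SelfExtension X) : HomOver (β_ Z X).hom (tensorL Z E) (E.tensorR Z) :=
  ⟨(β_ _ _).hom, by simp, by simp⟩

/-- The split sequence `0 ⟶ X ⟶ X ⊞ X ⟶ X ⟶ 0`. -/
abbrev split (X : C) : SelfExtension X where
  mid := X ⊞ X
  incl := biprod.inl
  proj := biprod.snd
  zero := by simp
  shortExact := (ShortComplex.Splitting.ofHasBinaryBiproduct X X).shortExact

attribute [local simp] pullback.lift_fst pullback.lift_snd pullback.lift_fst_assoc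
  pullback.lift_snd_assoc

/-- The isomorphism `split X ⋆ E ≅ E` induced by `((x, y), a) ↦ ι x + a`. -/
abbrev splitSum (E : SelfExtension X) : HomOver (𝟙 X) (yonedaSum (split X) E) E where
  mid := sumDesc (split X) E
    (pullback.fst _ _ ≫ biprod.fst ≫ E.incl + pullback.snd _ _) (by simp [antidiag])
  incl_mid := by
    change sumIncl (split X) E ≫ _ = 𝟙 X ≫ E.incl
    unfold sumIncl
    rw [sumMk_desc]
    simp
  mid_proj := by
    change _ ≫ E.proj = sumProj (split X) E ≫ 𝟙 X
    rw [← cancel_epi (sumQuot _ _), ← Category.assoc, sumQuot_desc, Category.comp_id,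
      sumQuot_proj, pullback.condition]
    simp [E.zero]

/-- The isomorphism `E ⋆ split X ≅ E` induced by `(a, (x, y)) ↦ a + ι x`. -/
abbrev sumSplit (E : SelfExtension X) : HomOver (𝟙 X) (yonedaSum E (split X)) E where
  mid := sumDesc E (split X)
    (pullback.fst _ _ + pullback.snd _ _ ≫ biprod.fst ≫ E.incl) (by simp [antidiag])
  incl_mid := by
    change sumIncl E (split X) ≫ _ = 𝟙 X ≫ E.incl
    unfold sumIncl
    rw [sumMk_desc]
    simp
  mid_proj := by
    change _ ≫ E.proj = sumProj E (split X) ≫ 𝟙 X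
    rw [← cancel_epi (sumQuot _ _), ← Category.assoc, sumQuot_desc, Category.comp_id,
      sumQuot_proj]
    simp [E.zero]

/-- `(1 ⊞ 1) ⊗ X ≅ X ⊞ X`. -/
@[simps]
def splitUnitR (X : C) : HomOver (λ_ X).hom ((split (𝟙_ C)).tensorR X) (split X) where
  mid := biprod.lift (biprod.fst ▷ X ≫ (λ_ X).hom) (biprod.snd ▷ X ≫ (λ_ X).hom)
  incl_mid := by
    apply biprod.hom_ext
    · simp [← comp_whiskerRight_assoc]
    · simp [← comp_whiskerRight_assoc]
  mid_proj := by simp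

/-- `X ⊗ (1 ⊞ 1) ≅ X ⊞ X`. -/
@[simps]
def splitUnitL (X : C) : HomOver (ρ_ X).hom (tensorL X (split (𝟙_ C))) (split X) where
  mid := biprod.lift (X ◁ biprod.fst ≫ (ρ_ X).hom) (X ◁ biprod.snd ≫ (ρ_ X).hom)
  incl_mid := by
    apply biprod.hom_ext
    · simp [← whiskerLeft_comp_assoc]
    · simp [← whiskerLeft_comp_assoc]
  mid_proj := by simp

/-- The left unit isomorphism of `C`, applied termwise. -/
@[simps]
def unitL (E : SelfExtension X) : HomOver (λ_ X).hom (tensorL (𝟙_ C) E) E :=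
  ⟨(λ_ _).hom, by simp, by simp⟩

/-- The right unit isomorphism of `C`, applied termwise. -/
@[simps]
def unitR (E : SelfExtension X) : HomOver (ρ_ X).hom (E.tensorR (𝟙_ C)) E :=
  ⟨(ρ_ _).hom, by simp, by simp⟩

end SelfExtension

namespace Prolongation

open SelfExtension

/-- The tensor product `A ⊗ B`: the Yoneda sum of `A ⊗ B₀` and `A₀ ⊗ B`. -/
abbrev tensorObj (A B : Prolongation C) : Prolongation C where
  base := A.base ⊗ B.base
  ext := yonedaSum (A.ext.tensorR B.base) (tensorL A.base B.ext)

/-- The tensor product of morphisms, induced by `f₁ ⊗ g₀` and `f₀ ⊗ g₁`. -/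
abbrev tensorHom {A B A' B' : Prolongation C} (f : A ⟶ A') (g : B ⟶ B') :
    tensorObj A B ⟶ tensorObj A' B' where
  base := f.base ⊗ₘ g.base
  ext := sumMap (f.ext.tensorR g.base) (HomOver.tensorL f.base g.ext)

variable (C) in
/-- The unit object `0 ⟶ 1 ⟶ 1 ⊞ 1 ⟶ 1 ⟶ 0`. -/
abbrev unit : Prolongation C where
  base := 𝟙_ C
  ext := split (𝟙_ C)

/-- The associativity constraint, over that of `C`: it is the composite
`(A₁B₀ ⋆ A₀B₁)C₀ ⋆ (A₀B₀)C₁ ≅ ((A₁B₀)C₀ ⋆ (A₀B₁)C₀) ⋆ (A₀B₀)C₁ ≅`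
`(A₁B₀)C₀ ⋆ ((A₀B₁)C₀ ⋆ (A₀B₀)C₁) ≅ A₁(B₀C₀) ⋆ (A₀(B₁C₀) ⋆ A₀(B₀C₁)) ≅`
`A₁(B₀C₀) ⋆ A₀(B₁C₀ ⋆ B₀C₁)`. -/
def associator (A B D : Prolongation C) :
    tensorObj (tensorObj A B) D ≅ tensorObj A (tensorObj B D) :=
  isoOver (A := tensorObj (tensorObj A B) D) (B := tensorObj A (tensorObj B D))
    (α_ A.base B.base D.base)
    ((((sumMap (HomOver.symm (f := Iso.refl _)
            (sumTensorR (A.ext.tensorR B.base) (tensorL A.base B.ext) D.base))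
          (HomOver.id (tensorL (A.base ⊗ B.base) D.ext))).comp
        (sumAssoc _ _ _) (Category.id_comp _)).comp
      (sumMap (assocLLR A.ext B.base D.base)
        (sumMap (assocM A.base B.ext D.base) (assocR A.base B.base D.ext)))
        (Category.id_comp _)).comp
      (sumMap (HomOver.id _) (sumTensorL A.base (B.ext.tensorR D.base) (tensorL B.base D.ext)))
      (Category.comp_id _))

/-- The commutativity constraint, over that of `C`: `A₁B₀ ⋆ A₀B₁ ≅ B₀A₁ ⋆ B₁A₀ ≅ B₁A₀ ⋆ B₀A₁`. -/
def braiding (A B : Prolongation C) : tensorObj A B ≅ tensorObj B A :=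
  isoOver (A := tensorObj A B) (B := tensorObj B A) (β_ A.base B.base)
    ((sumMap (braidR A.ext B.base) (braidL A.base B.ext)).comp (sumSwap _ _) (Category.comp_id _))

/-- The left unit constraint, `(1 ⊞ 1)A₀ ⋆ 1A₁ ≅ (A₀ ⊞ A₀) ⋆ A₁ ≅ A₁`. -/
def leftUnitor (A : Prolongation C) : tensorObj (unit C) A ≅ A :=
  isoOver (A := tensorObj (unit C) A) (B := A) (λ_ A.base)
    ((sumMap (splitUnitR A.base) (unitL A.ext)).comp (splitSum A.ext) (Category.comp_id _))

/-- The right unit constraint, `A₁1 ⋆ A₀(1 ⊞ 1) ≅ A₁ ⋆ (A₀ ⊞ A₀) ≅ A₁`. -/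
def rightUnitor (A : Prolongation C) : tensorObj A (unit C) ≅ A :=
  isoOver (A := tensorObj A (unit C)) (B := A) (ρ_ A.base)
    ((sumMap (unitR A.ext) (splitUnitL A.base)).comp (sumSplit A.ext) (Category.comp_id _))

/-- The tensor product, unit object and constraints of the prolongation, as data. -/
instance tensorStruct : MonoidalCategoryStruct (Prolongation C) where
  tensorObj := tensorObj
  tensorHom := tensorHom
  whiskerLeft A _ _ g := tensorHom (𝟙 A) g
  whiskerRight f B := tensorHom f (𝟙 B)
  tensorUnit := unit C
  associator := associator
  leftUnitor := leftUnitor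
  rightUnitor := rightUnitor

/-- The map `A₁ ⊗ B₁ ⟶ (A ⊗ B)₁`, `a ⊗ b ↦ [(a ⊗ π b, π a ⊗ b)]`. -/
def tensorMid (A B : Prolongation C) : A.ext.mid ⊗ B.ext.mid ⟶ (tensorObj A B).ext.mid :=
  sumMk (A.ext.tensorR B.base) (tensorL A.base B.ext)
    (A.ext.mid ◁ B.ext.proj) (A.ext.proj ▷ B.ext.mid) (whisker_exchange _ _)

end Prolongation

end Tensor

/-! ## Monoidal structures on a category -/

section Monoidal

variable {D : Type u} [Category.{v} D]

/-- The given tensor product, unit object and constraints satisfy the axioms of a monoidal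
category. -/
def IsMonoidalStruct (S : MonoidalCategoryStruct D) : Prop :=
  ∃ M : MonoidalCategory D, M.toMonoidalCategoryStruct = S

/-- The monoidal category with the given data. -/
abbrev IsMonoidalStruct.monoidalCategory {S : MonoidalCategoryStruct D}
    (h : IsMonoidalStruct S) : MonoidalCategory D where
  __ := S
  tensorHom_def := by obtain ⟨M, rfl⟩ := h; exact M.tensorHom_def
  id_tensorHom_id := by obtain ⟨M, rfl⟩ := h; exact M.id_tensorHom_id
  tensorHom_comp_tensorHom := by obtain ⟨M, rfl⟩ := h; exact M.tensorHom_comp_tensorHom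
  whiskerLeft_id := by obtain ⟨M, rfl⟩ := h; exact M.whiskerLeft_id
  id_whiskerRight := by obtain ⟨M, rfl⟩ := h; exact M.id_whiskerRight
  associator_naturality := by obtain ⟨M, rfl⟩ := h; exact M.associator_naturality
  leftUnitor_naturality := by obtain ⟨M, rfl⟩ := h; exact M.leftUnitor_naturality
  rightUnitor_naturality := by obtain ⟨M, rfl⟩ := h; exact M.rightUnitor_naturality
  pentagon := by obtain ⟨M, rfl⟩ := h; exact M.pentagon
  triangle := by obtain ⟨M, rfl⟩ := h; exact M.triangle

end Monoidal

/-! ## Rigidity -/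

section Rigid

variable {C : Type u} [Category.{v} C] [MonoidalCategory C] [MonoidalClosed C]

/-- The dual `Hom(X, 1)`. -/
abbrev dualObj (X : C) : C := (ihom X).obj (𝟙_ C)

/-- The evaluation `X ⊗ Xᵛ ⟶ 1`. -/
abbrev dualEv (X : C) : X ⊗ dualObj X ⟶ 𝟙_ C := (ihom.ev X).app (𝟙_ C)

/-- The transpose of a morphism. -/
abbrev dualMap {X Y : C} (f : X ⟶ Y) : dualObj Y ⟶ dualObj X :=
  (MonoidalClosed.pre f).app (𝟙_ C)

variable [SymmetricCategory C]

/-- The canonical map from an object to its bidual. -/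
def toBidual (X : C) : X ⟶ dualObj (dualObj X) :=
  MonoidalClosed.curry ((β_ (dualObj X) X).hom ≫ dualEv X)

/-- The canonical map `Hom(X₁, Y₁) ⊗ Hom(X₂, Y₂) ⟶ Hom(X₁ ⊗ X₂, Y₁ ⊗ Y₂)`. -/
def ihomTensor (X₁ X₂ Y₁ Y₂ : C) :
    (ihom X₁).obj Y₁ ⊗ (ihom X₂).obj Y₂ ⟶ (ihom (X₁ ⊗ X₂)).obj (Y₁ ⊗ Y₂) :=
  MonoidalClosed.curry
    (tensorμ X₁ X₂ ((ihom X₁).obj Y₁) ((ihom X₂).obj Y₂) ≫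
      ((ihom.ev X₁).app Y₁ ⊗ₘ (ihom.ev X₂).app Y₂))

variable (C) in
/-- A closed symmetric monoidal category is rigid if every object is reflexive and internal homs
are compatible with the tensor product. -/
structure IsRigid : Prop where
  reflexive (X : C) : IsIso (toBidual X)
  isIso_ihomTensor (X₁ X₂ Y₁ Y₂ : C) : IsIso (ihomTensor X₁ X₂ Y₁ Y₂)

end Rigid

section Dual

variable {C : Type u} [Category.{v} C] [Abelian C] [MonoidalCategory C] [MonoidalPreadditive C]
  [MonoidalClosed C]

theorem dualMap_comp_eq_zero {X Y Z : C} (f : X ⟶ Y) (g : Y ⟶ Z) (h : f ≫ g = 0) :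
    dualMap g ≫ dualMap f = 0 := by
  apply MonoidalClosed.uncurry_injective
  rw [MonoidalClosed.uncurry_natural_left, MonoidalClosed.uncurry_pre, whisker_exchange_assoc,
    ← MonoidalClosed.uncurry_eq, MonoidalClosed.uncurry_pre, ← comp_whiskerRight_assoc, h,
    MonoidalPreadditive.zero_whiskerRight, zero_comp, MonoidalClosed.uncurry_eq,
    MonoidalPreadditive.whiskerLeft_zero, zero_comp]

/-- Exactness of the dual sequence `0 ⟶ Xᵛ ⟶ E₁ᵛ ⟶ Xᵛ ⟶ 0`, whose maps are the transposes of the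
projection and of the inclusion of `E`. -/
def SelfExtension.DualExact {X : C} (E : SelfExtension X) : Prop :=
  (ShortComplex.mk (dualMap E.proj) (dualMap E.incl)
    (dualMap_comp_eq_zero _ _ E.zero)).ShortExact

/-- The dual exact sequence. -/
abbrev SelfExtension.dual {X : C} (E : SelfExtension X) (h : E.DualExact) :
    SelfExtension (dualObj X) where
  mid := dualObj E.mid
  incl := dualMap E.proj
  proj := dualMap E.incl
  zero := dualMap_comp_eq_zero _ _ E.zero
  shortExact := h

abbrev Prolongation.dual (A : Prolongation C) (h : A.ext.DualExact) : Prolongation C where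
  base := dualObj A.base
  ext := A.ext.dual h

end Dual

end

/-! An exact sequence `A` is the object `A₁` with the endomorphism `ε = π ≫ i`, whose kernel and
image are `A₀`: a flat module over the dual numbers. The Yoneda sum defining `A ⊗ B` is then the
tensor product over the dual numbers. Concretely, `tensorMid` is an epimorphism from `A₁ ⊗ B₁`
(`epi_tensorMid`), and a map out of `A₁ ⊗ B₁` factors through it as soon as it does not distinguish
`ε ⊗ 1` from `1 ⊗ ε` (`exists_tensorMid_desc`).

A morphism is determined by its middle component, so every axiom may be tested after precomposition
with such epimorphisms. There, tensor products of morphisms, associativity and symmetry become those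
of `C` on the middle terms, and the axioms follow from those of `C`. Only the unit involves `ε`, and
the triangle needs that `ε` may act on either factor.

For rigidity, the evaluation of `A₁` is balanced and descends to `A ⊗ Aᵛ`. The coevaluation of `A₁`
must be lifted instead: the norm map embeds `(Aᵛ ⊗ A)₁` in `A₁ᵛ ⊗ A₁` as the part on which both
actions of `ε` agree (`exists_normMid_lift`). The zigzags are identities over `Π₀`, hence invertible
by the five lemma. Correcting the coevaluation makes one zigzag the identity; the other is then an
invertible idempotent. So `A` has a dual, `Hom(A, B) = Aᵛ ⊗ B`, and `Π₀` preserves internal homs. By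
the five lemma again, the canonical maps are invertible because they are so in `C`. -/

set_option linter.unusedSectionVars false

noncomputable section

/-! ### Maps of Yoneda sums and exactness of tensoring, on generalized elements -/

namespace SelfExtension

section

variable {C : Type u} [Category.{v} C] [Abelian C] {X Y : C}

theorem sumMk_sumMap {f : X ⟶ Y} {E F : SelfExtension X} {E' F' : SelfExtension Y}
    (m : HomOver f E E') (n : HomOver f F F') {T : C} (a : T ⟶ E.mid) (b : T ⟶ F.mid)
    (h : a ≫ E.proj = b ≫ F.proj) :
    sumMk E F a b h ≫ (sumMap m n).mid = sumMk E' F' (a ≫ m.mid) (b ≫ n.mid)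
      (by simp [m.mid_proj, n.mid_proj, reassoc_of% h]) := by
  rw [sumMk_desc, comp_sumMk]
  exact sumMk_congr _ _ _ (by simp [pullback.lift_fst_assoc]) (by simp [pullback.lift_snd_assoc])

theorem sumMk_sumSwap (E F : SelfExtension X) {T : C} (a : T ⟶ E.mid) (b : T ⟶ F.mid)
    (h : a ≫ E.proj = b ≫ F.proj) :
    sumMk E F a b h ≫ (sumSwap E F).mid = sumMk F E b a h.symm := by
  rw [sumMk_desc, comp_sumMk]
  exact sumMk_congr _ _ _ (by simp [pullback.lift_snd]) (by simp [pullback.lift_fst])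

/-- A compatible triple is a generalized element of the triple fibre product, of which both
bracketings are quotients. -/
theorem sumMk_sumAssoc (E F G : SelfExtension X) {T : C} (a : T ⟶ E.mid) (b : T ⟶ F.mid)
    (c : T ⟶ G.mid) (h : a ≫ E.proj = b ≫ F.proj) (h' : a ≫ E.proj = c ≫ G.proj) :
    sumMk (yonedaSum E F) G (sumMk E F a b h) c (by rw [sumMk_proj, h']) ≫
      (sumAssoc E F G).mid =
    sumMk E (yonedaSum F G) a (sumMk F G b c (by rw [← h, h'])) (by rw [sumMk_proj, h]) := by
  let t : T ⟶ triple E F G := pullback.lift (pullback.lift a b h) c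
    (by rw [pullback.lift_fst_assoc, h'])
  have h₁ : sumMk (yonedaSum E F) G (sumMk E F a b h) c (by rw [sumMk_proj, h']) =
      t ≫ leftBracket E F G := by
    unfold leftBracket
    rw [comp_sumMk]
    apply sumMk_congr
    · rw [comp_sumMk]
      exact sumMk_congr _ _ _ (by simp [t, pullback.lift_fst_assoc, pullback.lift_fst])
        (by simp [t, pullback.lift_fst_assoc, pullback.lift_snd])
    · simp [t, pullback.lift_snd]
  rw [h₁, Category.assoc, Abelian.comp_epiDesc]
  unfold rightBracket
  rw [comp_sumMk]
  apply sumMk_congr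
  · simp [t, pullback.lift_fst_assoc, pullback.lift_fst]
  · rw [comp_sumMk]
    exact sumMk_congr _ _ _ (by simp [t, pullback.lift_fst_assoc, pullback.lift_snd])
      (by simp [t, pullback.lift_snd])

@[simp]
theorem incl_proj (E : SelfExtension X) : E.incl ≫ E.proj = 0 := E.zero

@[simp]
theorem incl_proj_assoc (E : SelfExtension X) {Z : C} (f : X ⟶ Z) :
    E.incl ≫ E.proj ≫ f = 0 := by
  rw [← Category.assoc, incl_proj, zero_comp]

end

variable {C : Type u} [Category.{v} C] [Abelian C] [MonoidalCategory C] [MonoidalPreadditive C]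
  [SymmetricCategory C]
  [∀ X : C, PreservesFiniteLimits (tensorLeft X)]
  [∀ X : C, PreservesFiniteColimits (tensorLeft X)] {X Y : C}

instance (E : SelfExtension X) (Z : C) : Mono (E.incl ▷ Z) := (E.tensorR Z).shortExact.mono_f
instance (E : SelfExtension X) (Z : C) : Epi (E.proj ▷ Z) := (E.tensorR Z).shortExact.epi_g
instance (E : SelfExtension X) (Z : C) : Mono (Z ◁ E.incl) := (tensorL Z E).shortExact.mono_f
instance (E : SelfExtension X) (Z : C) : Epi (Z ◁ E.proj) := (tensorL Z E).shortExact.epi_g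

@[simp]
theorem incl_proj_whiskerRight (E : SelfExtension X) (Z : C) :
    E.incl ▷ Z ≫ E.proj ▷ Z = 0 := (E.tensorR Z).zero

@[simp]
theorem whiskerLeft_incl_proj (E : SelfExtension X) (Z : C) :
    Z ◁ E.incl ≫ Z ◁ E.proj = 0 := (tensorL Z E).zero

@[simp]
theorem incl_proj_whiskerRight_assoc (E : SelfExtension X) (Z : C) {W : C} (f : X ⊗ Z ⟶ W) :
    E.incl ▷ Z ≫ E.proj ▷ Z ≫ f = 0 := by
  rw [← Category.assoc, incl_proj_whiskerRight, zero_comp]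

theorem exists_lift_whiskerRight (E : SelfExtension X) {Z T : C} (x : T ⟶ E.mid ⊗ Z)
    (hx : x ≫ E.proj ▷ Z = 0) : ∃ w : T ⟶ X ⊗ Z, x = w ≫ E.incl ▷ Z :=
  (E.tensorR Z).exists_lift x hx

theorem exists_lift_whiskerLeft (E : SelfExtension X) {Z T : C} (x : T ⟶ Z ⊗ E.mid)
    (hx : x ≫ Z ◁ E.proj = 0) : ∃ w : T ⟶ Z ⊗ X, x = w ≫ Z ◁ E.incl :=
  (tensorL Z E).exists_lift x hx

/-- An element of `E₁ ⊗ F₁` with vanishing image in `X ⊗ F₁` and in `E₁ ⊗ Y` comes from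
`X ⊗ Y`. -/
theorem exists_lift_of_proj_eq_zero (E : SelfExtension X) (F : SelfExtension Y) {T : C}
    (x : T ⟶ E.mid ⊗ F.mid) (h₁ : x ≫ E.mid ◁ F.proj = 0) (h₂ : x ≫ E.proj ▷ F.mid = 0) :
    ∃ w : T ⟶ X ⊗ Y, x = w ≫ E.incl ▷ Y ≫ E.mid ◁ F.incl := by
  obtain ⟨y, rfl⟩ := F.exists_lift_whiskerLeft x h₁
  have : y ≫ E.proj ▷ Y = 0 := by
    -- Tensoring with `X` keeps `F.incl` a monomorphism, so the vanishing can be tested in `X ⊗ F₁`.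
    rw [← cancel_mono (X ◁ F.incl), zero_comp, Category.assoc, ← whisker_exchange,
      ← Category.assoc, h₂]
  obtain ⟨z, rfl⟩ := E.exists_lift_whiskerRight y this
  exact ⟨z, by simp⟩

end SelfExtension

/-! ### The constraints computed on tensor products of middle terms -/

namespace Prolongation

open SelfExtension

section

variable {C : Type u} [Category.{v} C] [Abelian C]

@[simp] theorem id_mid (A : Prolongation C) : (𝟙 A : A ⟶ A).ext.mid = 𝟙 A.ext.mid := rfl

theorem comp_mid {A B D : Prolongation C} (f : A ⟶ B) (g : B ⟶ D) :
    (f ≫ g).ext.mid = f.ext.mid ≫ g.ext.mid := rfl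

/-- A morphism of the prolongation is determined by its middle component. -/
theorem hom_ext_mid {A B : Prolongation C} {f g : A ⟶ B} (h : f.ext.mid = g.ext.mid) : f = g := by
  refine hom_ext ?_ h
  rw [← cancel_epi A.ext.proj, ← f.ext.mid_proj, ← g.ext.mid_proj, h]

/-- A morphism of the prolongation is invertible if it is so over `Π₀`. -/
theorem isIso_of_base {A B : Prolongation C} (f : A ⟶ B) [IsIso f.base] : IsIso f :=
  (isoOver (asIso f.base) f.ext).isIso_hom

end

variable {C : Type u} [Category.{v} C] [Abelian C] [MonoidalCategory C] [MonoidalPreadditive C]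
  [SymmetricCategory C]
  [∀ X : C, PreservesFiniteLimits (tensorLeft X)]
  [∀ X : C, PreservesFiniteColimits (tensorLeft X)]

theorem tensorMid_proj (A B : Prolongation C) :
    tensorMid A B ≫ (tensorObj A B).ext.proj = A.ext.mid ◁ B.ext.proj ≫ A.ext.proj ▷ B.base :=
  sumMk_proj _ _ _ _ _

/-- Given a compatible pair `(a, b)`, a lift `y` of `a` to `A₁ ⊗ B₁` has the right first coordinate.
Its second coordinate is off by an element `w` of `A₀ ⊗ B₀`, which can be corrected. -/
instance epi_tensorMid (A B : Prolongation C) : Epi (tensorMid A B) := by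
  rw [epi_iff_surjective_up_to_refinements]
  intro T x
  obtain ⟨T₁, t₁, _, a, b, h, e⟩ :=
    exists_sumMk (A.ext.tensorR B.base) (tensorL A.base B.ext) x
  obtain ⟨T₂, t₂, _, y, hy⟩ := surjective_up_to_refinements_of_epi (A.ext.mid ◁ B.ext.proj) a
  have hz : (t₂ ≫ b - y ≫ A.ext.proj ▷ B.ext.mid) ≫ A.base ◁ B.ext.proj = 0 := by
    rw [Preadditive.sub_comp, Category.assoc, Category.assoc, ← whisker_exchange,
      ← reassoc_of% hy, ← h, sub_self]
  obtain ⟨w, hw⟩ := B.ext.exists_lift_whiskerLeft _ hz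
  obtain ⟨T₃, t₃, _, v, hv⟩ := surjective_up_to_refinements_of_epi (A.ext.proj ▷ B.base) w
  -- The correction lies in the image of `1 ⊗ i`, so `1 ⊗ π` does not see it, while `π ⊗ 1` maps it
  -- to the missing `w`.
  refine ⟨T₃, t₃ ≫ t₂ ≫ t₁, inferInstance, t₃ ≫ y + v ≫ A.ext.mid ◁ B.ext.incl, ?_⟩
  simp only [Category.assoc, e]
  rw [tensorMid, comp_sumMk, comp_sumMk, comp_sumMk]
  apply sumMk_congr
  · simp [hy]
  · rw [Preadditive.add_comp, Category.assoc, Category.assoc, whisker_exchange,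
      ← reassoc_of% hv, ← hw]
    simp

/-- The components `f₁ ⊗ g₀` and `f₀ ⊗ g₁` are both induced by `f₁ ⊗ g₁`, since `f₁` and `g₁`
commute with the projections. -/
theorem tensorMid_tensorHom {A B A' B' : Prolongation C} (f : A ⟶ A') (g : B ⟶ B') :
    tensorMid A B ≫ (tensorHom f g).ext.mid = (f.ext.mid ⊗ₘ g.ext.mid) ≫ tensorMid A' B' := by
  unfold tensorMid
  rw [sumMk_sumMap, comp_sumMk]
  apply sumMk_congr
  · simp only [HomOver.tensorR_mid, MonoidalCategory.tensorHom_def, Category.assoc]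
    rw [← whiskerLeft_comp, g.ext.mid_proj, whiskerLeft_comp, whisker_exchange_assoc]
  · simp only [HomOver.tensorL_mid, MonoidalCategory.tensorHom_def', Category.assoc]
    rw [← comp_whiskerRight, f.ext.mid_proj, comp_whiskerRight, ← whisker_exchange_assoc]

theorem tensorMid_braiding (A B : Prolongation C) :
    tensorMid A B ≫ (braiding A B).hom.ext.mid =
      (β_ A.ext.mid B.ext.mid).hom ≫ tensorMid B A := by
  change sumMk _ _ _ _ _ ≫ (sumMap _ _).mid ≫ (sumSwap _ _).mid = _
  rw [← Category.assoc, sumMk_sumMap, sumMk_sumSwap, tensorMid, comp_sumMk]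
  apply sumMk_congr <;> simp

/-- The action of `1 ⊞ 1` on `A₁`, `(x, y) ⊗ a ↦ x i(π a) + y a`. -/
theorem tensorMid_leftUnitor (A : Prolongation C) :
    tensorMid (unit C) A ≫ (leftUnitor A).hom.ext.mid =
      biprod.fst ▷ A.ext.mid ≫ (λ_ _).hom ≫ A.ext.proj ≫ A.ext.incl +
        biprod.snd ▷ A.ext.mid ≫ (λ_ _).hom := by
  change sumMk _ _ _ _ _ ≫ (sumMap _ _).mid ≫ (splitSum _).mid = _
  rw [← Category.assoc, sumMk_sumMap, sumMk_desc]
  simp [pullback.lift_fst_assoc, pullback.lift_snd, whisker_exchange_assoc]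

theorem tensorMid_rightUnitor (A : Prolongation C) :
    tensorMid A (unit C) ≫ (rightUnitor A).hom.ext.mid =
      A.ext.mid ◁ biprod.snd ≫ (ρ_ _).hom +
        A.ext.mid ◁ biprod.fst ≫ (ρ_ _).hom ≫ A.ext.proj ≫ A.ext.incl := by
  change sumMk _ _ _ _ _ ≫ (sumMap _ _).mid ≫ (sumSplit _).mid = _
  rw [← Category.assoc, sumMk_sumMap, sumMk_desc]
  simp [pullback.lift_fst, pullback.lift_snd_assoc, ← whisker_exchange_assoc,
    add_comm]

/-- Both sides send `a ⊗ b ⊗ d` to the class of the triple `(a ⊗ πb ⊗ πd, πa ⊗ b ⊗ πd, πa ⊗ πb ⊗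
d)`. -/
theorem tensorMid_associator (A B D : Prolongation C) :
    tensorMid A B ▷ D.ext.mid ≫ tensorMid (tensorObj A B) D ≫ (associator A B D).hom.ext.mid =
      (α_ _ _ _).hom ≫ A.ext.mid ◁ tensorMid B D ≫ tensorMid A (tensorObj B D) := by
  -- The first factor of the associator distributes `- ⊗ D₀` over the Yoneda sum; this yields the
  -- first two entries of the triple.
  have hl : tensorMid A B ▷ D.ext.mid ≫ (tensorObj A B).ext.mid ◁ D.ext.proj ≫
      (HomOver.symm (f := Iso.refl _)
        (sumTensorR (A.ext.tensorR B.base) (tensorL A.base B.ext) D.base)).mid =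
      sumMk ((A.ext.tensorR B.base).tensorR D.base) ((tensorL A.base B.ext).tensorR D.base)
        (((A.ext.mid ⊗ B.ext.mid) ◁ D.ext.proj) ≫ (A.ext.mid ◁ B.ext.proj) ▷ D.base)
        (((A.ext.mid ⊗ B.ext.mid) ◁ D.ext.proj) ≫ (A.ext.proj ▷ B.ext.mid) ▷ D.base)
        (by rw [Category.assoc, Category.assoc, ← comp_whiskerRight, ← comp_whiskerRight,
          whisker_exchange A.ext.proj B.ext.proj]) := by
    have := (sumTensorR (A.ext.tensorR B.base) (tensorL A.base B.ext) D.base).isIso_mid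
    rw [← whisker_exchange_assoc]
    change _ ≫ _ ≫ inv (sumTensorR _ _ _).mid = _
    rw [← Category.assoc, IsIso.comp_inv_eq, ← comp_sumMk _ _ _ _ _
      (by rw [← comp_whiskerRight, ← comp_whiskerRight, whisker_exchange]), Category.assoc]
    congr 1
    exact map_sumMk (tensorRight D.base) _ _ _ _ _
  -- The last factor, collecting `A₀ ⊗ -`, applied to the last two entries of the triple.
  have hr : A.base ◁ tensorMid B D =
      sumMk (tensorL A.base (B.ext.tensorR D.base)) (tensorL A.base (tensorL B.base D.ext))
        (A.base ◁ B.ext.mid ◁ D.ext.proj) (A.base ◁ B.ext.proj ▷ D.ext.mid)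
        (by simp [← whiskerLeft_comp, whisker_exchange]) ≫
      (sumTensorL A.base (B.ext.tensorR D.base) (tensorL B.base D.ext)).mid :=
    map_sumMk (tensorLeft A.base) _ _ _ _ _
  change _ ≫ sumMk _ _ _ _ _ ≫ (((sumMap _ _).mid ≫ (sumAssoc _ _ _).mid) ≫
    (sumMap _ _).mid) ≫ (sumMap _ _).mid = _
  have hz : (tensorMid A B ▷ D.ext.mid ≫ (tensorObj A B).ext.proj ▷ D.ext.mid) ≫ 𝟙 _ =
      (A.ext.mid ◁ B.ext.proj ≫ A.ext.proj ▷ B.base) ▷ D.ext.mid := by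
    rw [Category.comp_id, ← comp_whiskerRight, tensorMid_proj]
  rw [Category.assoc, Category.assoc, ← Category.assoc, comp_sumMk, ← Category.assoc, sumMk_sumMap]
  rw [sumMk_congr _ _ _ ((Category.assoc _ _ _).trans hl) hz]
  rw [← Category.assoc, sumMk_sumAssoc _ _ _ _ _ _ _ (by
    rw [Category.assoc, ← comp_whiskerRight, whisker_exchange])]
  rw [← Category.assoc, sumMk_sumMap, sumMk_sumMap]
  refine Eq.trans ?_ ((congrArg (_ ≫ ·) (comp_sumMk _ _ _ _ _ _)).trans
    (comp_sumMk _ _ _ _ _ _)).symm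
  apply sumMk_congr
  · rw [← whiskerLeft_comp, tensorMid_proj]
    simp
  · rw [sumMk_sumMap]
    refine Eq.trans ?_ ((congrArg ((α_ _ _ _).hom ≫ ·)
      ((whisker_exchange _ _).trans (congrArg (A.ext.proj ▷ _ ≫ ·) hr))).trans
      ((congrArg (_ ≫ ·) (Category.assoc _ _ _).symm).trans (Category.assoc _ _ _).symm)).symm
    refine congrArg (· ≫ _) ?_
    rw [comp_sumMk, comp_sumMk]
    apply sumMk_congr
    · rw [whisker_exchange (A.ext.proj ▷ B.ext.mid) D.ext.proj]
      simp
    · rw [whisker_exchange A.ext.proj B.ext.proj]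
      simp

end Prolongation

/-! ### The axioms of a symmetric monoidal category, and `Π₀` -/

namespace Prolongation

open SelfExtension

variable {C : Type u} [Category.{v} C] [Abelian C] [MonoidalCategory C] [MonoidalPreadditive C]
  [SymmetricCategory C]
  [∀ X : C, PreservesFiniteLimits (tensorLeft X)]
  [∀ X : C, PreservesFiniteColimits (tensorLeft X)]

/-- Lets whiskered copies of `tensorMid` be cancelled, so that iterated products are tested on `A₁ ⊗
B₁ ⊗ D₁` and longer tensor products. -/
instance epi_whiskerRight' {X Y : C} (f : X ⟶ Y) [Epi f] (Z : C) : Epi (f ▷ Z) :=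
  inferInstanceAs (Epi ((tensorRight Z).map f))

instance epi_whiskerLeft' {X Y : C} (f : X ⟶ Y) [Epi f] (Z : C) : Epi (Z ◁ f) :=
  inferInstanceAs (Epi ((tensorLeft Z).map f))

theorem tensorMid_whiskerRight {A A' : Prolongation C} (f : A ⟶ A') (B : Prolongation C) :
    tensorMid A B ≫ (tensorHom f (𝟙 B)).ext.mid = f.ext.mid ▷ B.ext.mid ≫ tensorMid A' B := by
  rw [tensorMid_tensorHom, id_mid, tensorHom_id]

theorem tensorMid_whiskerLeft (A : Prolongation C) {B B' : Prolongation C} (g : B ⟶ B') :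
    tensorMid A B ≫ (tensorHom (𝟙 A) g).ext.mid = A.ext.mid ◁ g.ext.mid ≫ tensorMid A B' := by
  rw [tensorMid_tensorHom, id_mid, id_tensorHom]

theorem tensorHom_eq {A B A' B' : Prolongation C} (f : A ⟶ A') (g : B ⟶ B') :
    tensorHom f g = tensorHom f (𝟙 B) ≫ tensorHom (𝟙 A') g := by
  apply hom_ext_mid
  rw [← cancel_epi (tensorMid A B), comp_mid, reassoc_of% tensorMid_whiskerRight,
    tensorMid_whiskerLeft,
    tensorMid_tensorHom, MonoidalCategory.tensorHom_def, Category.assoc]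

theorem tensorHom_id_id (A B : Prolongation C) : tensorHom (𝟙 A) (𝟙 B) = 𝟙 (tensorObj A B) := by
  apply hom_ext_mid
  rw [← cancel_epi (tensorMid A B), tensorMid_tensorHom]
  simp

theorem tensorHom_comp {A B A' B' A'' B'' : Prolongation C} (f : A ⟶ A') (g : B ⟶ B')
    (f' : A' ⟶ A'') (g' : B' ⟶ B'') :
    tensorHom f g ≫ tensorHom f' g' = tensorHom (f ≫ f') (g ≫ g') := by
  apply hom_ext_mid
  rw [← cancel_epi (tensorMid A B), comp_mid, reassoc_of% tensorMid_tensorHom, tensorMid_tensorHom,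
    tensorMid_tensorHom, tensorHom_comp_tensorHom_assoc, comp_mid, comp_mid]

theorem associator_naturality {A B D A' B' D' : Prolongation C} (f : A ⟶ A') (g : B ⟶ B')
    (h : D ⟶ D') :
    tensorHom (tensorHom f g) h ≫ (associator A' B' D').hom =
      (associator A B D).hom ≫ tensorHom f (tensorHom g h) := by
  apply hom_ext_mid
  rw [← cancel_epi (tensorMid (tensorObj A B) D), ← cancel_epi (tensorMid A B ▷ D.ext.mid),
    comp_mid, comp_mid, reassoc_of% tensorMid_tensorHom, reassoc_of% tensorMid_associator,
    tensorMid_tensorHom,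
    ← tensorHom_id, tensorHom_comp_tensorHom_assoc, tensorMid_tensorHom, Category.id_comp,
    ← id_tensorHom A.ext.mid, tensorHom_comp_tensorHom_assoc, tensorMid_tensorHom,
    Category.id_comp, ← Category.comp_id h.ext.mid, ← tensorHom_comp_tensorHom_assoc,
    tensorHom_id, tensorMid_associator, Category.comp_id, ← Category.comp_id f.ext.mid,
    ← tensorHom_comp_tensorHom_assoc, id_tensorHom, Category.comp_id,
    MonoidalCategory.associator_naturality_assoc]

/-- After three cancellations this is the pentagon of `C` for the four middle terms. -/
theorem pentagon (A B D E : Prolongation C) :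
    tensorHom (associator A B D).hom (𝟙 E) ≫ (associator A (tensorObj B D) E).hom ≫
        tensorHom (𝟙 A) (associator B D E).hom =
      (associator (tensorObj A B) D E).hom ≫ (associator A B (tensorObj D E)).hom := by
  have h₁ : tensorMid A B ▷ D.ext.mid ▷ E.ext.mid ≫ tensorMid (tensorObj A B) D ▷ E.ext.mid ≫
      (associator A B D).hom.ext.mid ▷ E.ext.mid =
      (α_ _ _ _).hom ▷ E.ext.mid ≫ (A.ext.mid ◁ tensorMid B D) ▷ E.ext.mid ≫
        tensorMid A (tensorObj B D) ▷ E.ext.mid := by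
    simpa only [comp_whiskerRight] using
      congrArg (· ▷ E.ext.mid) (tensorMid_associator A B D)
  have h₂ : A.ext.mid ◁ tensorMid B D ▷ E.ext.mid ≫ A.ext.mid ◁ tensorMid (tensorObj B D) E ≫
      A.ext.mid ◁ (associator B D E).hom.ext.mid =
      A.ext.mid ◁ (α_ _ _ _).hom ≫ A.ext.mid ◁ B.ext.mid ◁ tensorMid D E ≫
        A.ext.mid ◁ tensorMid B (tensorObj D E) := by
    simpa only [whiskerLeft_comp] using
      congrArg (A.ext.mid ◁ ·) (tensorMid_associator B D E)
  apply hom_ext_mid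
  rw [← cancel_epi (tensorMid (tensorObj (tensorObj A B) D) E),
    ← cancel_epi (tensorMid (tensorObj A B) D ▷ E.ext.mid),
    ← cancel_epi (tensorMid A B ▷ D.ext.mid ▷ E.ext.mid)]
  rw [comp_mid, comp_mid, comp_mid, reassoc_of% tensorMid_whiskerRight, reassoc_of% h₁,
    reassoc_of% tensorMid_associator,
    tensorMid_whiskerLeft, reassoc_of% tensorMid_associator, associator_naturality_left_assoc,
    ← whisker_exchange_assoc, tensorMid_associator A B (tensorObj D E)]
  simp only [associator_naturality_middle_assoc, associator_naturality_right_assoc,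
    reassoc_of% h₂, MonoidalCategory.pentagon_assoc]

theorem leftUnitor_naturality {A B : Prolongation C} (f : A ⟶ B) :
    tensorHom (𝟙 (unit C)) f ≫ (leftUnitor B).hom = (leftUnitor A).hom ≫ f := by
  apply hom_ext_mid
  rw [← cancel_epi (tensorMid (unit C) A), comp_mid, comp_mid, reassoc_of% tensorMid_whiskerLeft,
    tensorMid_leftUnitor, reassoc_of% tensorMid_leftUnitor]
  simp only [Preadditive.add_comp, Preadditive.comp_add, Category.assoc, f.ext.incl_mid,
    whisker_exchange_assoc, leftUnitor_naturality_assoc, MonoidalCategory.leftUnitor_naturality,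
    reassoc_of% f.ext.mid_proj]

theorem rightUnitor_naturality {A B : Prolongation C} (f : A ⟶ B) :
    tensorHom f (𝟙 (unit C)) ≫ (rightUnitor B).hom = (rightUnitor A).hom ≫ f := by
  apply hom_ext_mid
  rw [← cancel_epi (tensorMid A (unit C)), comp_mid, comp_mid, reassoc_of% tensorMid_whiskerRight,
    tensorMid_rightUnitor, reassoc_of% tensorMid_rightUnitor]
  simp only [Preadditive.add_comp, Preadditive.comp_add, Category.assoc, f.ext.incl_mid,
    ← whisker_exchange_assoc, rightUnitor_naturality_assoc,
    MonoidalCategory.rightUnitor_naturality, reassoc_of% f.ext.mid_proj]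

/-- The element `ε = i π` of the dual numbers acts on either factor of a tensor product. -/
theorem whiskerLeft_proj_incl_tensorMid (A B : Prolongation C) :
    A.ext.mid ◁ (B.ext.proj ≫ B.ext.incl) ≫ tensorMid A B =
      (A.ext.proj ≫ A.ext.incl) ▷ B.ext.mid ≫ tensorMid A B := by
  unfold tensorMid
  rw [comp_sumMk, comp_sumMk, sumMk_eq_iff]
  -- The two pairs are `(0, πa ⊗ iπb)` and `(iπa ⊗ πb, 0)`, the two inclusions of `πa ⊗ πb`; the
  -- sign is that of the antidiagonal.
  refine ⟨-(A.ext.mid ◁ B.ext.proj ≫ A.ext.proj ▷ B.base), ?_, ?_⟩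
  · simp [whisker_exchange]
  · simp only [whiskerLeft_comp, comp_whiskerRight, Preadditive.neg_comp, Category.assoc,
      sub_neg_eq_add, whisker_exchange A.ext.proj B.ext.incl, incl_proj_whiskerRight, comp_zero,
      zero_add]

/-- On `a ⊗ (x, y) ⊗ b` the `y` terms agree by the triangle of `C`. The `x` terms are `a ⊗ εb` and
`εa ⊗ b`, which the Yoneda sum identifies. -/
theorem triangle (A B : Prolongation C) :
    (associator A (unit C) B).hom ≫ tensorHom (𝟙 A) (leftUnitor B).hom =
      tensorHom (rightUnitor A).hom (𝟙 B) := by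
  apply hom_ext_mid
  rw [← cancel_epi (tensorMid (tensorObj A (unit C)) B),
    ← cancel_epi (tensorMid A (unit C) ▷ B.ext.mid), comp_mid, reassoc_of% tensorMid_associator,
    tensorMid_whiskerLeft, tensorMid_whiskerRight, ← whiskerLeft_comp_assoc,
    ← comp_whiskerRight_assoc, tensorMid_leftUnitor, tensorMid_rightUnitor]
  simp only [MonoidalPreadditive.whiskerLeft_add, MonoidalPreadditive.add_whiskerRight,
    Preadditive.add_comp, Preadditive.comp_add]
  rw [add_comm]
  congr 1
  · simp
  · have := whiskerLeft_proj_incl_tensorMid A B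
    simp only [whiskerLeft_comp, comp_whiskerRight, Category.assoc] at this ⊢
    rw [this]
    simp

theorem hexagon (A B D : Prolongation C) :
    (associator A B D).hom ≫ (braiding A (tensorObj B D)).hom ≫ (associator B D A).hom =
      tensorHom (braiding A B).hom (𝟙 D) ≫ (associator B A D).hom ≫
        tensorHom (𝟙 B) (braiding A D).hom := by
  apply hom_ext_mid
  rw [← cancel_epi (tensorMid (tensorObj A B) D), ← cancel_epi (tensorMid A B ▷ D.ext.mid),
    comp_mid, comp_mid, comp_mid, comp_mid, reassoc_of% tensorMid_associator,
    reassoc_of% tensorMid_braiding, reassoc_of% tensorMid_whiskerRight,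
    ← comp_whiskerRight_assoc, tensorMid_braiding, comp_whiskerRight_assoc,
    reassoc_of% tensorMid_associator, tensorMid_whiskerLeft, ← whiskerLeft_comp_assoc,
    tensorMid_braiding, whiskerLeft_comp_assoc, BraidedCategory.braiding_naturality_right_assoc,
    tensorMid_associator, BraidedCategory.hexagon_forward_assoc]

theorem braiding_naturality {A B A' B' : Prolongation C} (f : A ⟶ A') (g : B ⟶ B') :
    tensorHom f g ≫ (braiding A' B').hom = (braiding A B).hom ≫ tensorHom g f := by
  apply hom_ext_mid
  rw [← cancel_epi (tensorMid A B), comp_mid, comp_mid, reassoc_of% tensorMid_tensorHom,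
    tensorMid_braiding, reassoc_of% tensorMid_braiding, tensorMid_tensorHom,
    BraidedCategory.braiding_naturality_assoc]

theorem braiding_braiding (A B : Prolongation C) :
    (braiding A B).hom ≫ (braiding B A).hom = 𝟙 _ := by
  apply hom_ext_mid
  rw [← cancel_epi (tensorMid A B), comp_mid, reassoc_of% tensorMid_braiding, tensorMid_braiding,
    SymmetricCategory.symmetry_assoc, id_mid, Category.comp_id]

variable (C) in
/-- The monoidal structure on the prolongation. -/
abbrev monoidalCategory : MonoidalCategory (Prolongation C) where
  __ := tensorStruct
  tensorHom_def := tensorHom_eq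
  id_tensorHom_id := tensorHom_id_id
  tensorHom_comp_tensorHom := tensorHom_comp
  whiskerLeft_id := tensorHom_id_id
  id_whiskerRight := tensorHom_id_id
  associator_naturality := associator_naturality
  leftUnitor_naturality := leftUnitor_naturality
  rightUnitor_naturality := rightUnitor_naturality
  pentagon := pentagon
  triangle := triangle

attribute [local instance] monoidalCategory

variable (C) in
/-- The symmetric structure on the prolongation. -/
abbrev symmetricCategory : SymmetricCategory (Prolongation C) where
  braiding := braiding
  braiding_naturality_right A _ _ f := braiding_naturality (𝟙 A) f
  braiding_naturality_left f B := braiding_naturality f (𝟙 B)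
  hexagon_forward := hexagon
  hexagon_reverse A B D := by
    -- By symmetry, the reverse hexagon is the inverse of the forward one for `D, A, B`.
    have h : α_ D A B ≪≫ braiding D (tensorObj A B) ≪≫ α_ A B D =
        whiskerRightIso (braiding D A) B ≪≫ α_ A D B ≪≫ whiskerLeftIso A (braiding D B) :=
      Iso.ext (hexagon D A B)
    have hβ (A B : Prolongation C) : (braiding A B).inv = (braiding B A).hom :=
      Iso.inv_ext (braiding_braiding A B)
    have h' := congrArg Iso.inv h
    simp only [Iso.trans_inv, whiskerRightIso_inv, whiskerLeftIso_inv, Category.assoc, hβ] at h'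
    exact h'
  symmetry := braiding_braiding

attribute [local instance] symmetricCategory

variable (C) in
/-- The symmetric monoidal structure of `Π₀`, given by identities. -/
abbrev braidedPi₀ : (Pi₀ C).Braided where
  toMonoidal := Functor.CoreMonoidal.toMonoidal
    { εIso := Iso.refl _
      μIso := fun A B => Iso.refl (A.base ⊗ B.base)
      μIso_hom_natural_left := fun f B => by
        change f.base ▷ B.base ≫ 𝟙 _ = 𝟙 _ ≫ (f.base ⊗ₘ 𝟙 B.base)
        simp
      μIso_hom_natural_right := fun A f => by
        change A.base ◁ f.base ≫ 𝟙 _ = 𝟙 _ ≫ (𝟙 A.base ⊗ₘ f.base)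
        simp
      associativity := fun A B D => by
        change 𝟙 (A.base ⊗ B.base) ▷ D.base ≫ 𝟙 _ ≫ (α_ A.base B.base D.base).hom =
          (α_ A.base B.base D.base).hom ≫ A.base ◁ 𝟙 (B.base ⊗ D.base) ≫ 𝟙 _
        simp
      left_unitality := fun A => by
        change (λ_ A.base).hom = 𝟙 (𝟙_ C) ▷ A.base ≫ 𝟙 _ ≫ (λ_ A.base).hom
        simp
      right_unitality := fun A => by
        change (ρ_ A.base).hom = A.base ◁ 𝟙 (𝟙_ C) ≫ 𝟙 _ ≫ (ρ_ A.base).hom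
        simp }
  braided A B := by
    change 𝟙 _ ≫ (β_ A.base B.base).hom = (β_ A.base B.base).hom ≫ 𝟙 _
    simp

end Prolongation

/-! ### Zigzags and duality in a monoidal category -/

section Zigzag

variable {D : Type u} [Category.{v} D] [MonoidalCategory D]

/-- The composite `A ⟶ A ⊗ (B ⊗ A) ≅ (A ⊗ B) ⊗ A ⟶ A`. -/
def zigzagLeft {A B : D} (e : A ⊗ B ⟶ 𝟙_ D) (c : 𝟙_ D ⟶ B ⊗ A) : A ⟶ A :=
  (ρ_ A).inv ≫ A ◁ c ≫ (α_ A B A).inv ≫ e ▷ A ≫ (λ_ A).hom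

/-- The composite `B ⟶ (B ⊗ A) ⊗ B ≅ B ⊗ (A ⊗ B) ⟶ B`. -/
def zigzagRight {A B : D} (e : A ⊗ B ⟶ 𝟙_ D) (c : 𝟙_ D ⟶ B ⊗ A) : B ⟶ B :=
  (λ_ B).inv ≫ c ▷ B ≫ (α_ B A B).hom ≫ B ◁ e ≫ (ρ_ B).hom

/-- Both sides insert `c` between `A` and `B` and then evaluate two disjoint pairs; the order of the
evaluations is immaterial. -/
theorem whiskerLeft_zigzagRight_comp {A B : D} (e : A ⊗ B ⟶ 𝟙_ D) (c : 𝟙_ D ⟶ B ⊗ A) :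
    A ◁ zigzagRight e c ≫ e = zigzagLeft e c ▷ B ≫ e := by
  unfold zigzagLeft zigzagRight
  calc
    _ = 𝟙 _ ⊗≫ A ◁ c ▷ B ⊗≫ ((A ⊗ B) ◁ e ≫ e ▷ 𝟙_ D) ⊗≫ 𝟙 _ := by monoidal
    _ = 𝟙 _ ⊗≫ A ◁ c ▷ B ⊗≫ (e ▷ (A ⊗ B) ≫ 𝟙_ D ◁ e) ⊗≫ 𝟙 _ := by rw [whisker_exchange]
    _ = _ := by monoidal

theorem comp_zigzagRight {A B B' : D} (e : A ⊗ B ⟶ 𝟙_ D) (c : 𝟙_ D ⟶ B ⊗ A) (f : B' ⟶ B) :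
    f ≫ zigzagRight e c =
      (λ_ B').inv ≫ c ▷ B' ≫ (α_ B A B').hom ≫ B ◁ (A ◁ f ≫ e) ≫ (ρ_ B).hom := by
  unfold zigzagRight
  rw [leftUnitor_inv_naturality_assoc, whisker_exchange_assoc]
  simp

/-- A map after the zigzag can be absorbed into `c`; with `f` the inverse of the zigzag, this
repairs the coevaluation without touching `e`. -/
theorem zigzagLeft_comp {A B A' : D} (e : A ⊗ B ⟶ 𝟙_ D) (c : 𝟙_ D ⟶ B ⊗ A) (f : A ⟶ A') :
    zigzagLeft e c ≫ f =
      (ρ_ A).inv ≫ A ◁ (c ≫ B ◁ f) ≫ (α_ A B A').inv ≫ e ▷ A' ≫ (λ_ A').hom := by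
  unfold zigzagLeft
  simp only [Category.assoc]
  rw [← MonoidalCategory.leftUnitor_naturality, ← whisker_exchange_assoc]
  simp

/-- If one zigzag is the identity, the other one is idempotent. -/
theorem zigzagRight_idempotent {A B : D} (e : A ⊗ B ⟶ 𝟙_ D) (c : 𝟙_ D ⟶ B ⊗ A)
    (h : zigzagLeft e c = 𝟙 A) : zigzagRight e c ≫ zigzagRight e c = zigzagRight e c := by
  rw [comp_zigzagRight, whiskerLeft_zigzagRight_comp, h, id_whiskerRight, Category.id_comp]
  rfl

/-- An invertible idempotent is the identity. -/
theorem zigzagRight_eq_id {A B : D} (e : A ⊗ B ⟶ 𝟙_ D) (c : 𝟙_ D ⟶ B ⊗ A)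
    (h : zigzagLeft e c = 𝟙 A) [IsIso (zigzagRight e c)] : zigzagRight e c = 𝟙 B := by
  rw [← cancel_epi (zigzagRight e c), zigzagRight_idempotent e c h, Category.comp_id]

theorem whiskerLeft_comp_of_zigzagLeft {A B : D} {e : A ⊗ B ⟶ 𝟙_ D} {c : 𝟙_ D ⟶ B ⊗ A}
    (h : zigzagLeft e c = 𝟙 A) :
    A ◁ c ≫ (α_ A B A).inv ≫ e ▷ A = (ρ_ A).hom ≫ (λ_ A).inv := by
  rw [← Iso.inv_comp_eq, ← cancel_mono (λ_ A).hom]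
  simpa [zigzagLeft] using h

/-- The duality given by an evaluation and a coevaluation whose zigzags are identities. -/
abbrev exactPairingOfZigzag {A B : D} (e : A ⊗ B ⟶ 𝟙_ D) (c : 𝟙_ D ⟶ B ⊗ A)
    (h : zigzagLeft e c = 𝟙 A) (h' : zigzagRight e c = 𝟙 B) : ExactPairing B A where
  coevaluation' := c
  evaluation' := e
  coevaluation_evaluation' := whiskerLeft_comp_of_zigzagLeft h
  evaluation_coevaluation' := by
    rw [← Iso.inv_comp_eq, ← cancel_mono (ρ_ B).hom]
    simpa [zigzagRight] using h'

end Zigzag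

/-! ### Coevaluations in a rigid category -/

section Rigid

open MonoidalClosed

variable {C : Type u} [Category.{v} C] [MonoidalCategory C] [MonoidalClosed C]

theorem whiskerLeft_dualMap_comp_dualEv {X Y : C} (f : X ⟶ Y) :
    X ◁ dualMap f ≫ dualEv X = f ▷ dualObj Y ≫ dualEv Y :=
  id_tensor_pre_app_comp_ev f _

theorem isIso_curry_leftUnitor (Y : C) :
    IsIso (curry (λ_ Y).hom : Y ⟶ (ihom (𝟙_ C)).obj Y) := by
  refine ⟨(λ_ _).inv ≫ (ihom.ev _).app Y, ?_, ?_⟩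
  · rw [leftUnitor_inv_naturality_assoc, whiskerLeft_curry_ihom_ev_app, Iso.inv_hom_id]
  · apply uncurry_injective
    rw [uncurry_natural_left, uncurry_curry, uncurry_id_eq_ev,
      MonoidalCategory.leftUnitor_naturality, Iso.hom_inv_id_assoc]

theorem isIso_pre_app {X Y : C} (f : X ⟶ Y) [IsIso f] (Z : C) : IsIso ((pre f).app Z) := by
  refine ⟨(pre (inv f)).app Z, ?_, ?_⟩ <;> rw [← NatTrans.comp_app, ← pre_map] <;> simp

/-- The canonical map `Xᵛ ⊗ Y ⟶ Hom(X, Y)`. -/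
def dualTensor (X Y : C) : dualObj X ⊗ Y ⟶ (ihom X).obj Y :=
  curry ((α_ _ _ _).inv ≫ dualEv X ▷ Y ≫ (λ_ Y).hom)

variable [SymmetricCategory C]

/-- The case `X₂ = Y₁ = 1` of the canonical map of internal homs, up to `Y ≅ Hom(1, Y)` and unit
constraints; hence invertibility in the rigid case. -/
theorem dualTensor_eq (X Y : C) :
    dualTensor X Y = dualObj X ◁ curry (λ_ Y).hom ≫ ihomTensor X (𝟙_ C) (𝟙_ C) Y ≫
      (pre (ρ_ X).inv).app _ ≫ (ihom X).map (λ_ Y).hom := by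
  apply uncurry_injective
  rw [dualTensor, uncurry_curry, uncurry_natural_left, uncurry_natural_left, uncurry_natural_right,
    uncurry_pre, ihomTensor, Category.assoc, whisker_exchange_assoc]
  rw [← Category.assoc (_ ◁ curry _), ← uncurry_eq, uncurry_curry, whisker_exchange_assoc,
    ← id_tensorHom (dualObj X), Category.assoc, tensorμ_natural_right_assoc, whiskerLeft_id,
    tensorHom_comp_tensorHom_assoc, Category.id_comp, whiskerLeft_curry_ihom_ev_app]
  simp only [tensorμ, braiding_tensorUnit_left, MonoidalCategory.tensorHom_def]
  monoidal

theorem IsRigid.isIso_dualTensor (h : IsRigid C) (X Y : C) : IsIso (dualTensor X Y) := by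
  have := h.isIso_ihomTensor X (𝟙_ C) (𝟙_ C) Y
  have := isIso_curry_leftUnitor Y
  have := isIso_pre_app (ρ_ X).inv (𝟙_ C ⊗ Y)
  rw [dualTensor_eq]
  infer_instance

/-- The coevaluation of an object of a rigid category. -/
def IsRigid.coev (h : IsRigid C) (X : C) : 𝟙_ C ⟶ dualObj X ⊗ X :=
  haveI := h.isIso_dualTensor X X
  -- The element of `Hom(X, X)` that names the identity, moved to `Xᵛ ⊗ X`.
  curry (ρ_ X).hom ≫ inv (dualTensor X X)

theorem IsRigid.zigzagLeft_eq (h : IsRigid C) (X : C) : zigzagLeft (dualEv X) (h.coev X) = 𝟙 X := by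
  have := h.isIso_dualTensor X X
  have hc : h.coev X ≫ dualTensor X X = curry (ρ_ X).hom := by simp [coev]
  have := congrArg uncurry hc
  rw [uncurry_natural_left, dualTensor, uncurry_curry, uncurry_curry] at this
  rw [zigzagLeft, this, Iso.inv_hom_id]

/-- A map into `Xᵛ` is determined by its pairing with `X`, and there the right zigzag turns into the
left one. -/
theorem IsRigid.zigzagRight_eq (h : IsRigid C) (X : C) :
    zigzagRight (dualEv X) (h.coev X) = 𝟙 (dualObj X) := by
  apply uncurry_injective
  rw [uncurry_eq, uncurry_id_eq_ev]
  refine (whiskerLeft_zigzagRight_comp _ _).trans ?_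
  rw [h.zigzagLeft_eq, id_whiskerRight, Category.id_comp]

/-- Both sides correspond to the element of `Hom(X, Y)` that names `f`, by the left zigzags of `X`
and of `Y`. -/
theorem IsRigid.coev_comp_whiskerLeft (h : IsRigid C) {X Y : C} (f : X ⟶ Y) :
    h.coev X ≫ dualObj X ◁ f = h.coev Y ≫ dualMap f ▷ Y := by
  have := h.isIso_dualTensor X Y
  rw [← cancel_mono (dualTensor X Y)]
  apply uncurry_injective
  rw [dualTensor, uncurry_natural_left, uncurry_natural_left, uncurry_curry,
    ← cancel_epi (ρ_ X).inv, ← zigzagLeft_comp, h.zigzagLeft_eq, whiskerLeft_comp, Category.assoc,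
    associator_inv_naturality_middle_assoc, ← comp_whiskerRight_assoc,
    whiskerLeft_dualMap_comp_dualEv, comp_whiskerRight_assoc,
    ← associator_inv_naturality_left_assoc, whisker_exchange_assoc,
    ← rightUnitor_inv_naturality_assoc]
  exact (Category.id_comp f).trans ((Category.comp_id f).symm.trans
    (congrArg (f ≫ ·) (h.zigzagLeft_eq Y).symm))

end Rigid

/-! ### Exactness of the dual sequence -/

section DualExact

open MonoidalClosed SelfExtension

variable {C : Type u} [Category.{v} C] [Abelian C] [MonoidalCategory C] [MonoidalPreadditive C]
  [SymmetricCategory C]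
  [∀ X : C, PreservesFiniteLimits (tensorLeft X)]
  [∀ X : C, PreservesFiniteColimits (tensorLeft X)] [MonoidalClosed C]

/-- By the right zigzag, `g` is recovered from `h.coev X ≫ g ▷ X`. If `dualMap f ≫ g = 0`, that map
vanishes after the monomorphism `Z ◁ f`, by dinaturality of the coevaluation. -/
theorem IsRigid.epi_dualMap (h : IsRigid C) {X Y : C} (f : X ⟶ Y) [Mono f] : Epi (dualMap f) := by
  apply Preadditive.epi_of_cancel_zero
  intro Z g hg
  have : Mono (Z ◁ f) := inferInstanceAs (Mono ((tensorLeft Z).map f))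
  have key : h.coev X ≫ g ▷ X = 0 := by
    rw [← cancel_mono (Z ◁ f), Category.assoc, ← whisker_exchange, ← Category.assoc,
      h.coev_comp_whiskerLeft, Category.assoc, ← comp_whiskerRight, hg]
    simp
  rw [← Category.id_comp g, ← h.zigzagRight_eq X, zigzagRight]
  simp only [Category.assoc, ← rightUnitor_naturality, whisker_exchange_assoc]
  rw [← associator_naturality_left_assoc, ← comp_whiskerRight_assoc, key]
  simp

/-- Only surjectivity uses rigidity. The rest is formal: maps from `T` to a dual are maps from a
tensor product with `T` to the unit, and `E ⊗ T` is exact. -/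
theorem IsRigid.dualExact (h : IsRigid C) {X : C} (E : SelfExtension X) : E.DualExact := by
  have hm : Mono (dualMap E.proj) := by
    apply Preadditive.mono_of_cancel_zero
    intro T x hx
    apply uncurry_injective
    have := congrArg uncurry hx
    rw [uncurry_pre_app] at this
    rw [← cancel_epi (E.proj ▷ T), this, uncurry_eq, uncurry_eq]
    simp
  have he : Epi (dualMap E.incl) := h.epi_dualMap _
  refine { exact := ?_, mono_f := hm, epi_g := he }
  rw [ShortComplex.exact_iff_exact_up_to_refinements]
  intro T x hx
  dsimp at x hx
  have := congrArg uncurry hx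
  rw [uncurry_pre_app, uncurry_eq 0, MonoidalPreadditive.whiskerLeft_zero, zero_comp] at this
  let y := (E.tensorR T).shortExact.exact.desc (uncurry x) this
  have hy : E.proj ▷ T ≫ y = uncurry x := (E.tensorR T).shortExact.exact.g_desc (uncurry x) this
  refine ⟨T, 𝟙 T, inferInstance, curry y, ?_⟩
  rw [Category.id_comp]
  apply uncurry_injective
  dsimp
  rw [uncurry_pre_app, uncurry_curry, hy]

end DualExact

/-! ### `(A ⊗ B)₁` as a quotient and, by the norm map, as a subobject of `A₁ ⊗ B₁` -/

namespace Prolongation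

open SelfExtension MonoidalClosed

section

variable {C : Type u} [Category.{v} C] [Abelian C] [MonoidalCategory C] [MonoidalPreadditive C]
  [SymmetricCategory C]
  [∀ X : C, PreservesFiniteLimits (tensorLeft X)]
  [∀ X : C, PreservesFiniteColimits (tensorLeft X)]

/-- A map out of `A₁ ⊗ B₁` that is balanced over the dual numbers factors through `(A ⊗ B)₁`. -/
theorem exists_tensorMid_desc (A B : Prolongation C) {Z : C} (m : A.ext.mid ⊗ B.ext.mid ⟶ Z)
    (h : A.ext.mid ◁ (B.ext.proj ≫ B.ext.incl) ≫ m =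
      (A.ext.proj ≫ A.ext.incl) ▷ B.ext.mid ≫ m) :
    ∃ m' : (tensorObj A B).ext.mid ⟶ Z, tensorMid A B ≫ m' = m := by
  -- After `1 ⊗ π` this is `i ⊗ ε` followed by `m`; moving `ε` to the other factor gives `i ≫ ε =
  -- 0`.
  have hi : A.ext.incl ▷ B.base ≫ A.ext.mid ◁ B.ext.incl ≫ m = 0 := by
    rw [← cancel_epi (A.base ◁ B.ext.proj), whisker_exchange_assoc, ← whiskerLeft_comp_assoc, h]
    simp
  have key : ∀ {T : C} (k : T ⟶ A.ext.mid ⊗ B.ext.mid), k ≫ tensorMid A B = 0 → k ≫ m = 0 := by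
    intro T k hk
    rw [tensorMid, comp_sumMk, sumMk_eq_zero_iff] at hk
    obtain ⟨w, h₁, h₂⟩ := hk
    dsimp only at h₁ h₂
    -- An element killed by `tensorMid` has coordinates on the antidiagonal, given by `w`. With `v`
    -- over `w`, subtracting `(ε ⊗ 1 - 1 ⊗ ε) v`, which `m` kills, makes both coordinates zero. The
    -- remainder comes from `A₀ ⊗ B₀`, and `m` kills that too.
    obtain ⟨T', t, _, v, hv⟩ := surjective_up_to_refinements_of_epi
      (A.ext.mid ◁ B.ext.proj ≫ A.ext.proj ▷ B.base) w
    obtain ⟨u, hu⟩ := A.ext.exists_lift_of_proj_eq_zero B.ext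
      (t ≫ k - v ≫ (A.ext.proj ≫ A.ext.incl) ▷ B.ext.mid +
        v ≫ A.ext.mid ◁ (B.ext.proj ≫ B.ext.incl))
      (by
        simp only [Preadditive.add_comp, Preadditive.sub_comp, Category.assoc, h₁,
          reassoc_of% hv, comp_whiskerRight, whiskerLeft_comp, whiskerLeft_incl_proj, comp_zero,
          ← whisker_exchange, ← whisker_exchange_assoc, sub_self, add_zero])
      (by
        simp only [Preadditive.add_comp, Preadditive.sub_comp, Category.assoc, h₂,
          Preadditive.comp_neg, reassoc_of% hv, comp_whiskerRight, whiskerLeft_comp,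
          incl_proj_whiskerRight, comp_zero, whisker_exchange]
        simp)
    rw [← cancel_epi t, comp_zero]
    have := congrArg (· ≫ m) hu
    simp only [Preadditive.add_comp, Preadditive.sub_comp, Category.assoc, h, hi, comp_zero] at this
    simpa using this
  exact ⟨Abelian.epiDesc _ m (key _ (kernel.condition _)), Abelian.comp_epiDesc _ _ _⟩

/-- Used to compute the restriction to `A₀ ⊗ B₀` of a map known only on `A₁ ⊗ B₁`. -/
theorem whiskerLeft_proj_comp_tensor_incl (A B : Prolongation C) :
    A.base ◁ B.ext.proj ≫ (tensorObj A B).ext.incl = A.ext.incl ▷ B.ext.mid ≫ tensorMid A B := by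
  change _ ≫ sumMk _ _ _ _ _ = _
  rw [tensorMid, comp_sumMk, comp_sumMk]
  apply sumMk_congr
  · rw [whisker_exchange]
  · simp

/-- The norm map `(A ⊗ B)₁ ⟶ A₁ ⊗ B₁`, `[(s, t)] ↦ (1 ⊗ i) s + (i ⊗ 1) t`. -/
def normMid (A B : Prolongation C) : (tensorObj A B).ext.mid ⟶ A.ext.mid ⊗ B.ext.mid :=
  sumDesc (A.ext.tensorR B.base) (tensorL A.base B.ext)
    (pullback.fst _ _ ≫ A.ext.mid ◁ B.ext.incl + pullback.snd _ _ ≫ A.ext.incl ▷ B.ext.mid)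
    (by simp [antidiag, pullback.lift_fst_assoc, pullback.lift_snd_assoc, whisker_exchange])

theorem sumMk_normMid (A B : Prolongation C) {T : C} (a : T ⟶ A.ext.mid ⊗ B.base)
    (b : T ⟶ A.base ⊗ B.ext.mid) (h : a ≫ A.ext.proj ▷ B.base = b ≫ A.base ◁ B.ext.proj) :
    sumMk (A.ext.tensorR B.base) (tensorL A.base B.ext) a b h ≫ normMid A B =
      a ≫ A.ext.mid ◁ B.ext.incl + b ≫ A.ext.incl ▷ B.ext.mid := by
  unfold normMid
  rw [sumMk_desc]
  simp [pullback.lift_fst_assoc, pullback.lift_snd_assoc]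

/-- `π ⊗ 1` kills the term `(i ⊗ 1) t` of the norm. This recovers the image in `A₀ ⊗ B₀` of an
element known through its norm. -/
theorem normMid_proj (A B : Prolongation C) :
    normMid A B ≫ A.ext.proj ▷ B.ext.mid = (tensorObj A B).ext.proj ≫ A.base ◁ B.ext.incl := by
  change _ = sumProj _ _ ≫ _
  rw [← cancel_epi (sumQuot _ _), ← Category.assoc, sumQuot_eq_mk, sumMk_normMid, ← Category.assoc,
    sumMk_proj]
  simp [whisker_exchange]

/-- If `(1 ⊗ i) a + (i ⊗ 1) b = 0`, applying `π ⊗ 1` shows that `a` comes from `A₀ ⊗ B₀`. Cancelling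
`i ⊗ 1` then puts `(a, b)` on the antidiagonal. -/
instance mono_normMid (A B : Prolongation C) : Mono (normMid A B) := by
  apply Preadditive.mono_of_cancel_zero
  intro T x hx
  obtain ⟨T', t, _, a, b, h, e⟩ := exists_sumMk _ _ x
  dsimp only at a b h
  rw [← cancel_epi t, comp_zero, e]
  have h₀ : a ≫ A.ext.mid ◁ B.ext.incl + b ≫ A.ext.incl ▷ B.ext.mid = 0 := by
    rw [← sumMk_normMid A B a b h, ← e, Category.assoc, hx, comp_zero]
  have h₁ : a ≫ A.ext.proj ▷ B.base = 0 := by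
    rw [← cancel_mono (A.base ◁ B.ext.incl), zero_comp, Category.assoc, ← whisker_exchange]
    simpa using congrArg (· ≫ A.ext.proj ▷ B.ext.mid) h₀
  obtain ⟨w, rfl⟩ := A.ext.exists_lift_whiskerRight a h₁
  rw [sumMk_eq_zero_iff]
  refine ⟨w, rfl, ?_⟩
  rw [← cancel_mono (A.ext.incl ▷ B.ext.mid), Preadditive.neg_comp, Category.assoc,
    whisker_exchange, eq_neg_iff_add_eq_zero, add_comm, ← Category.assoc, h₀]

/-- The norm map identifies `(A ⊗ B)₁` with the elements of `A₁ ⊗ B₁` on which both actions of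
the dual numbers agree. -/
theorem exists_normMid_lift (A B : Prolongation C) {T : C} (x : T ⟶ A.ext.mid ⊗ B.ext.mid)
    (h : x ≫ A.ext.mid ◁ (B.ext.proj ≫ B.ext.incl) =
      x ≫ (A.ext.proj ≫ A.ext.incl) ▷ B.ext.mid) :
    ∃ y : T ⟶ (tensorObj A B).ext.mid, y ≫ normMid A B = x := by
  have hpi : x ≫ A.ext.mid ◁ B.ext.proj ≫ A.ext.proj ▷ B.base = 0 := by
    rw [← cancel_mono (A.base ◁ B.ext.incl)]
    have := congrArg (· ≫ A.ext.proj ▷ B.ext.mid) h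
    simp only [whiskerLeft_comp, comp_whiskerRight, Category.assoc, incl_proj_whiskerRight,
      comp_zero, whisker_exchange] at this
    simpa only [Category.assoc, zero_comp] using this
  -- Agreement of the two actions means that both projections of `x` come from one `z` in `A₀ ⊗ B₀`.
  obtain ⟨z, hz⟩ := A.ext.exists_lift_whiskerRight (x ≫ A.ext.mid ◁ B.ext.proj)
    (by rw [Category.assoc, hpi])
  have hz' : x ≫ A.ext.proj ▷ B.ext.mid = z ≫ A.base ◁ B.ext.incl := by
    rw [← cancel_mono (A.ext.incl ▷ B.ext.mid), Category.assoc, Category.assoc,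
      ← comp_whiskerRight, ← h, whiskerLeft_comp, ← Category.assoc, hz, Category.assoc,
      whisker_exchange]
  have hj : ∃ (T' : C) (t : T' ⟶ T) (_ : Epi t) (y : T' ⟶ (tensorObj A B).ext.mid),
      t ≫ x = y ≫ normMid A B := by
    -- With `s` over `z`, the difference `x - (1 ⊗ i) s` dies under `π ⊗ 1`, so it equals `(i ⊗ 1)
    -- r`, and `x` is the norm of `[(s, r)]`.
    obtain ⟨T', t, _, s, hs⟩ := surjective_up_to_refinements_of_epi (A.ext.proj ▷ B.base) z
    obtain ⟨r, hr⟩ := A.ext.exists_lift_whiskerRight (t ≫ x - s ≫ A.ext.mid ◁ B.ext.incl) (by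
      rw [Preadditive.sub_comp, Category.assoc, Category.assoc, hz', whisker_exchange,
        reassoc_of% hs, sub_self])
    have hr' : s ≫ A.ext.proj ▷ B.base = r ≫ A.base ◁ B.ext.proj := by
      rw [← cancel_mono (A.ext.incl ▷ B.base), Category.assoc r, whisker_exchange,
        ← Category.assoc r, ← hr, Preadditive.sub_comp, Category.assoc t, hz, ← Category.assoc t,
        hs]
      simp
    refine ⟨T', t, inferInstance, sumMk (A.ext.tensorR B.base) (tensorL A.base B.ext) s r hr', ?_⟩
    rw [sumMk_normMid, ← hr]
    abel
  obtain ⟨T', t, _, y, hy⟩ := hj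
  -- The lift found on the cover `T'` descends to `T` because the norm is a monomorphism.
  have hk : kernel.ι t ≫ y = 0 := by
    rw [← cancel_mono (normMid A B), Category.assoc, ← hy]
    simp
  refine ⟨Abelian.epiDesc t y hk, ?_⟩
  rw [← cancel_epi t, Abelian.comp_epiDesc_assoc, hy]

end

/-! ### Evaluation, coevaluation and duals in the prolongation -/

section

variable {C : Type u} [Category.{v} C] [Abelian C] [MonoidalCategory C] [MonoidalPreadditive C]
  [SymmetricCategory C]
  [∀ X : C, PreservesFiniteLimits (tensorLeft X)]
  [∀ X : C, PreservesFiniteColimits (tensorLeft X)] [MonoidalClosed C]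

/-- On `A₁ᵛ`, `ε` acts as the transpose of `ε` on `A₁`. Hence the evaluation of `A₁` is balanced and
descends to `(A ⊗ Aᵛ)₁`. -/
theorem exists_evaluation (A : Prolongation C) (hA : A.ext.DualExact) :
    ∃ e : tensorObj A (A.dual hA) ⟶ unit C, e.base = dualEv A.base ∧
      tensorMid A (A.dual hA) ≫ e.ext.mid ≫ biprod.fst = dualEv A.ext.mid := by
  obtain ⟨m, hm⟩ := exists_tensorMid_desc A (A.dual hA) (dualEv A.ext.mid) (by
    simp only [whiskerLeft_comp, comp_whiskerRight, Category.assoc]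
    erw [whiskerLeft_dualMap_comp_dualEv A.ext.proj, whisker_exchange_assoc]
    rw [whiskerLeft_dualMap_comp_dualEv A.ext.incl])
  have : Epi (A.base ◁ (A.dual hA).ext.proj) :=
    (tensorL A.base (A.ext.dual hA)).shortExact.epi_g
  have hi : (tensorObj A (A.dual hA)).ext.incl ≫ m = dualEv A.base := by
    rw [← cancel_epi (A.base ◁ (A.dual hA).ext.proj),
      reassoc_of% whiskerLeft_proj_comp_tensor_incl, hm]
    exact (whiskerLeft_dualMap_comp_dualEv A.ext.incl).symm
  -- The second coordinate is forced by lying over the evaluation of `A₀`.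
  refine ⟨⟨dualEv A.base, ⟨biprod.lift m ((tensorObj A (A.dual hA)).ext.proj ≫ dualEv A.base),
    ?_, ?_⟩⟩, rfl, ?_⟩
  · apply biprod.hom_ext
    · simpa using hi
    · rw [Category.assoc, biprod.lift_snd, (tensorObj A (A.dual hA)).ext.incl_proj_assoc]
      simp
  · simp
  · simpa using hm

/-- Dinaturality, applied to `ε`, says that both actions agree on the coevaluation of `A₁`, so it
lifts through the norm map. -/
theorem exists_coevaluation (h : IsRigid C) (A : Prolongation C) :
    ∃ c : unit C ⟶ tensorObj (A.dual (h.dualExact A.ext)) A, c.base = h.coev A.base := by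
  let A' := A.dual (h.dualExact A.ext)
  obtain ⟨y, hy⟩ := exists_normMid_lift A' A (h.coev A.ext.mid) (by
    rw [h.coev_comp_whiskerLeft, dualMap, pre_map]
    rfl)
  have hp : y ≫ (tensorObj A' A).ext.proj = h.coev A.base := by
    rw [← cancel_mono (A'.base ◁ A.ext.incl), Category.assoc, ← normMid_proj, reassoc_of% hy]
    exact (h.coev_comp_whiskerLeft A.ext.incl).symm
  refine ⟨⟨h.coev A.base, ⟨biprod.desc (h.coev A.base ≫ (tensorObj A' A).ext.incl) y,
    ?_, ?_⟩⟩, rfl⟩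
  · exact biprod.inl_desc _ _
  · apply biprod.hom_ext'
    · rw [biprod.inl_desc_assoc, Category.assoc, (tensorObj A' A).ext.incl_proj]
      simp
    · simpa using hp

attribute [local instance] monoidalCategory symmetricCategory

theorem zigzagLeft_base {A B : Prolongation C} (e : A ⊗ B ⟶ 𝟙_ (Prolongation C))
    (c : 𝟙_ (Prolongation C) ⟶ B ⊗ A) :
    (zigzagLeft e c).base = zigzagLeft (D := C) e.base c.base := by
  change (ρ_ A.base).inv ≫ (𝟙 A.base ⊗ₘ c.base) ≫ (α_ A.base B.base A.base).inv ≫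
    (e.base ⊗ₘ 𝟙 A.base) ≫ (λ_ A.base).hom = _
  rw [id_tensorHom, tensorHom_id]
  rfl

theorem zigzagRight_base {A B : Prolongation C} (e : A ⊗ B ⟶ 𝟙_ (Prolongation C))
    (c : 𝟙_ (Prolongation C) ⟶ B ⊗ A) :
    (zigzagRight e c).base = zigzagRight (D := C) e.base c.base := by
  change (λ_ B.base).inv ≫ (c.base ⊗ₘ 𝟙 B.base) ≫ (α_ B.base A.base B.base).hom ≫
    (𝟙 B.base ⊗ₘ e.base) ≫ (ρ_ B.base).hom = _
  rw [id_tensorHom, tensorHom_id]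
  rfl

/-- The first zigzag is known to be the identity only over `Π₀`, so it is invertible but need not be
the identity. Only the coevaluation is modified, so the conditions on the evaluation survive. -/
theorem exists_exactPairing (h : IsRigid C) (A : Prolongation C) :
    ∃ p : ExactPairing (A.dual (h.dualExact A.ext)) A,
      p.evaluation'.base = dualEv A.base ∧
      tensorMid A (A.dual (h.dualExact A.ext)) ≫ p.evaluation'.ext.mid ≫ biprod.fst =
        dualEv A.ext.mid := by
  obtain ⟨e, he, he'⟩ := exists_evaluation A (h.dualExact A.ext)
  obtain ⟨c, hc⟩ := exists_coevaluation h A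
  let A' := A.dual (h.dualExact A.ext)
  change A ⊗ A' ⟶ 𝟙_ _ at e
  change 𝟙_ _ ⟶ A' ⊗ A at c
  have ht : (zigzagLeft e c).base = 𝟙 A.base := by
    rw [zigzagLeft_base, he, hc]
    exact h.zigzagLeft_eq A.base
  have : IsIso (zigzagLeft e c).base := by rw [ht]; infer_instance
  have := isIso_of_base (zigzagLeft e c)
  have hi : (inv (zigzagLeft e c)).base = 𝟙 A.base := by
    have := congrArg Hom.base (IsIso.hom_inv_id (zigzagLeft e c))
    rw [comp_base, ht] at this
    exact (Category.id_comp _).symm.trans this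
  -- The correction is the identity over `Π₀`, so `c'` still lies over the coevaluation of `A₀`.
  let c' := c ≫ A' ◁ inv (zigzagLeft e c)
  have hl : zigzagLeft e c' = 𝟙 A := by
    rw [← IsIso.hom_inv_id (zigzagLeft e c), zigzagLeft_comp]
    rfl
  have hc' : c'.base = h.coev A.base := by
    change c.base ≫ (𝟙 A'.base ⊗ₘ (inv (zigzagLeft e c)).base) = _
    rw [hi, hc, id_tensorHom_id]
    exact Category.comp_id _
  have hr : (zigzagRight e c').base = 𝟙 A'.base := by
    rw [zigzagRight_base, he, hc']
    exact h.zigzagRight_eq A.base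
  have : IsIso (zigzagRight e c').base := by rw [hr]; infer_instance
  have := isIso_of_base (zigzagRight e c')
  exact ⟨exactPairingOfZigzag e c' hl (zigzagRight_eq_id e c' hl), he, he'⟩

end

end Prolongation

/-! ### Internal homs and rigidity of the prolongation -/

namespace Prolongation

open SelfExtension MonoidalClosed

variable {C : Type u} [Category.{v} C] [Abelian C] [MonoidalCategory C] [MonoidalPreadditive C]
  [SymmetricCategory C]
  [∀ X : C, PreservesFiniteLimits (tensorLeft X)]
  [∀ X : C, PreservesFiniteColimits (tensorLeft X)] [MonoidalClosed C]

attribute [local instance] monoidalCategory symmetricCategory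

/-- The closed structure on the prolongation of a rigid category, given by
`Hom(A, B) = Aᵛ ⊗ B`. -/
abbrev monoidalClosed (h : IsRigid C) : MonoidalClosed (Prolongation C) where
  closed A :=
    haveI : HasLeftDual A :=
      { leftDual := A.dual (h.dualExact A.ext), exact := (exists_exactPairing h A).choose }
    closedOfHasLeftDual A

theorem tensorμ_base (A B A' B' : Prolongation C) :
    (tensorμ A B A' B').base = tensorμ A.base B.base A'.base B'.base := by
  change (α_ A.base B.base (A'.base ⊗ B'.base)).hom ≫
    (𝟙 A.base ⊗ₘ (α_ B.base A'.base B'.base).inv) ≫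
      (𝟙 A.base ⊗ₘ ((β_ B.base A'.base).hom ⊗ₘ 𝟙 B'.base)) ≫
        (𝟙 A.base ⊗ₘ (α_ A'.base B.base B'.base).hom) ≫
          (α_ A.base A'.base (B.base ⊗ B'.base)).inv = _
  simp [tensorμ]

section

variable [MonoidalClosed (Prolongation C)]

/-- The comparison map `Hom(A, B)₀ ⟶ Hom(A₀, B₀)`. -/
def ihomBase (A B : Prolongation C) : ((ihom A).obj B).base ⟶ (ihom A.base).obj B.base :=
  curry ((ihom.ev A).app B).base

theorem curry_base_comp_ihomBase {A B T : Prolongation C} (f : A ⊗ T ⟶ B) :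
    (curry f).base ≫ ihomBase A B =
      (curry (C := C) (A := A.base) (Y := T.base) (X := B.base) f.base) := by
  rw [ihomBase, ← curry_natural_left]
  congr 1
  have hf : A ◁ curry f ≫ (ihom.ev A).app B = f := by rw [← uncurry_eq, uncurry_curry]
  conv_rhs => rw [← hf]
  change _ = (𝟙 A.base ⊗ₘ (curry f).base) ≫ _
  rw [id_tensorHom]

/-- Over `Π₀`, currying in the prolongation is currying in `C` up to the comparison map; the five
lemma does the rest. -/
theorem isIso_curry_of_base {A B T : Prolongation C} [IsIso (ihomBase A B)] (f : A ⊗ T ⟶ B)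
    (hf : IsIso (curry (C := C) (A := A.base) (Y := T.base) (X := B.base) f.base)) :
    IsIso (curry f) := by
  have : IsIso ((curry f).base ≫ ihomBase A B) := by rwa [curry_base_comp_ihomBase]
  have : IsIso (curry f).base := IsIso.of_isIso_comp_right _ (ihomBase A B)
  exact isIso_of_base _

theorem ev_base_eq (A B : Prolongation C) :
    ((ihom.ev A).app B).base = A.base ◁ ihomBase A B ≫ (ihom.ev A.base).app B.base := by
  rw [ihomBase, whiskerLeft_curry_ihom_ev_app]

/-- Rigidity of the prolongation can be checked on `Π₀`, if `Π₀` preserves internal homs. -/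
theorem isRigid_of_isIso_ihomBase (h : IsRigid C)
    (hb : ∀ A B : Prolongation C, IsIso (ihomBase A B)) : IsRigid (Prolongation C) where
  reflexive A := by
    have := h.reflexive A.base
    have := isIso_pre_app (ihomBase A (𝟙_ _)) (𝟙_ C)
    refine isIso_curry_of_base _ ?_
    have : curry (C := C) (A := (dualObj A).base) (Y := A.base) (X := 𝟙_ C)
        ((β_ (dualObj A) A).hom ≫ dualEv A).base =
        toBidual A.base ≫ dualMap (ihomBase A (𝟙_ _)) := by
      rw [toBidual, dualMap, curry_pre_app]
      congr 1
      change (β_ (dualObj A).base A.base).hom ≫ (dualEv A).base = _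
      rw [dualEv, ev_base_eq, ← BraidedCategory.braiding_naturality_left_assoc]
      rfl
    rw [this]
    exact IsIso.comp_isIso
  isIso_ihomTensor X₁ X₂ Y₁ Y₂ := by
    have := h.isIso_ihomTensor X₁.base X₂.base Y₁.base Y₂.base
    refine isIso_curry_of_base _ ?_
    have : curry (C := C) (A := X₁.base ⊗ X₂.base)
        (Y := ((ihom X₁).obj Y₁).base ⊗ ((ihom X₂).obj Y₂).base) (X := Y₁.base ⊗ Y₂.base)
        (tensorμ X₁ X₂ ((ihom X₁).obj Y₁) ((ihom X₂).obj Y₂) ≫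
          ((ihom.ev X₁).app Y₁ ⊗ₘ (ihom.ev X₂).app Y₂)).base =
        (ihomBase X₁ Y₁ ⊗ₘ ihomBase X₂ Y₂) ≫ ihomTensor X₁.base X₂.base Y₁.base Y₂.base := by
      rw [ihomTensor, ← curry_natural_left, tensorμ_natural_right_assoc,
        tensorHom_comp_tensorHom, ← ev_base_eq, ← ev_base_eq]
      congr 1
      change Hom.base (tensorμ X₁ X₂ _ _) ≫ _ = _
      rw [tensorμ_base]
      rfl
    exact this ▸ IsIso.comp_isIso

end

/-- For `Hom(A, B) = Aᵛ ⊗ B` the comparison map is the canonical `A₀ᵛ ⊗ B₀ ⟶ Hom(A₀, B₀)`,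
invertible by rigidity of `C`. -/
theorem isIso_ihomBase (h : IsRigid C) (A B : Prolongation C) :
    letI := monoidalClosed h
    IsIso (ihomBase A B) := by
  let _ := monoidalClosed h
  have hev : ((ihom.ev A).app B).base =
      (α_ A.base (dualObj A.base) B.base).inv ≫ dualEv A.base ▷ B.base ≫ (λ_ B.base).hom := by
    rw [← (exists_exactPairing h A).choose_spec.1]
    -- The evaluation is the transpose of the identity of `Aᵛ ⊗ B`, whence the leading identity.
    have hev : (ihom.ev A).app B = A ◁ 𝟙 _ ≫ (α_ _ _ _).inv ≫
        (exists_exactPairing h A).choose.evaluation' ▷ B ≫ (λ_ B).hom := rfl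
    rw [hev, whiskerLeft_id, Category.id_comp]
    change _ ≫ (_ ⊗ₘ 𝟙 B.base) ≫ _ = _
    rw [tensorHom_id]
    rfl
  have := h.isIso_dualTensor A.base B.base
  have he : ihomBase A B = dualTensor A.base B.base := by
    rw [ihomBase, hev]
    rfl
  exact he ▸ this

end Prolongation

end

theorem mainTheorem9 {C : Type u} [Category.{v} C] [Abelian C] [MonoidalCategory C]
    [MonoidalPreadditive C] [SymmetricCategory C]
    [∀ X : C, PreservesFiniteLimits (tensorLeft X)]
    [∀ X : C, PreservesFiniteColimits (tensorLeft X)] :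
    ∃ hM : IsMonoidalStruct (D := Prolongation C) Prolongation.tensorStruct,
      letI : MonoidalCategory (Prolongation C) := hM.monoidalCategory
      ∃ _ : SymmetricCategory (Prolongation C),
        (∀ A B : Prolongation C, β_ A B = Prolongation.braiding A B) ∧
        (∃ _ : (Prolongation.Pi₀ C).Braided,
          Functor.LaxMonoidal.ε (Prolongation.Pi₀ C) = 𝟙 (𝟙_ C) ∧
          ∀ A B : Prolongation C,
            Functor.LaxMonoidal.μ (Prolongation.Pi₀ C) A B = 𝟙 (A.base ⊗ B.base)) ∧
        ∀ [MonoidalClosed C], IsRigid C →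
          ∃ _ : MonoidalClosed (Prolongation C), IsRigid (Prolongation C) ∧
            ∀ A : Prolongation C, ∃ (hA : A.ext.DualExact)
                (e : A ⊗ A.dual hA ⟶ 𝟙_ (Prolongation C)),
              e.base = dualEv A.base ∧
              Prolongation.tensorMid A (A.dual hA) ≫ e.ext.mid ≫ biprod.fst = dualEv A.ext.mid ∧
              IsIso (MonoidalClosed.curry e) := by
  refine ⟨⟨Prolongation.monoidalCategory C, rfl⟩, Prolongation.symmetricCategory C, fun A B => rfl,
    ⟨Prolongation.braidedPi₀ C, rfl, fun A B => rfl⟩, fun hC => ?_⟩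
  let _ := Prolongation.monoidalCategory C
  let _ := Prolongation.symmetricCategory C
  let _ := Prolongation.monoidalClosed hC
  refine ⟨Prolongation.monoidalClosed hC,
    Prolongation.isRigid_of_isIso_ihomBase hC (Prolongation.isIso_ihomBase hC), fun A => ?_⟩
  obtain ⟨p, hp, hp'⟩ := Prolongation.exists_exactPairing hC A
  refine ⟨hC.dualExact A.ext, p.evaluation', hp, hp', ?_⟩
  have := Prolongation.isIso_ihomBase hC A (Prolongation.unit C)
  refine Prolongation.isIso_curry_of_base _ ?_
  -- Currying the evaluation of `A₀` gives the identity of its dual.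
  rw [hp, dualEv, ← MonoidalClosed.uncurry_id_eq_ev, MonoidalClosed.curry_uncurry]
  infer_instance
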